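/- A $3$-graph is a finite hypergraph $H$ with at least one vertex, all of whose edges have exactly three vertices. For $n\ge 0$ let $K_n^{(3)}$ be the complete $3$-graph on $n$ vertices. The local rainbow colouring number $C_3(n,H)$ is the least $k$ for which there are $n$ edge-colourings $f_v : E(K_n^{(3)})\to\{1,\dots,k\}$, one for each vertex $v$ of $K_n^{(3)}$, such that every copy $T$ of $H$ in $K_n^{(3)}$ has a vertex $u\in V(T)$ for which $f_u$ is rainbow on $T$, that is, no two distinct edges of $T$ have the same colour under $f_u$. Let $\mathcal H$ be the family of all $3$-graphs with at most $3$ edges, except the following three $3$-graphs, possibly with some isolated vertices added: - $\mathrm{TP}_3$, with vertices $a,b,c,d,e$ and edges $abc, bcd, cde$; - $\mathrm{SP}_3$, with vertices $a,b,c,d,e,f$ and edges $abc, bcd, def$; - $\mathrm{LC}_3$, with vertices $a,b,c,d,e,f$ and edges $abd, bce, acf$. Theorem. Let $H$ be a $3$-graph. 1. If $H\in\mathcal H$, then $C_3(n,H)\le 7$ for every $n$. 2. If $H\notin\mathcal H$, then $$C_3(n,H)=\Omega\left(\left(\frac{\log^{(3)} n}{\log^{(4)} n}\right)^{1/16}\right)\qquad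 (n\to\infty),$$ where $\log^{(r)}$ is the $r$-fold iterated logarithm and the implied positive constant may depend on $H$. Consequently $C_3(n,H)$ is bounded by a constant independent of $n$ if and only if $H\in\mathcal H$. -/

import Mathlib

namespace LocalRainbow

/-- A hypergraph is `r`-uniform (an `r`-graph) if each of its edges has exactly `r` vertices.
Edges are stored as sets of vertices, and `ncard` is `0` on infinite sets, so for `r ≠ 0` all edges
are finite. -/
def IsUniform {α : Type*} (r : ℕ) (H : Hypergraph α) : Prop :=
  ∀ e ∈ H.edgeSet, e.ncard = r

/-- The edges of the complete `r`-graph on `n` labelled vertices: all `r`-subsets. -/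
abbrev CompleteEdge (r n : ℕ) : Type :=
  {e : Set (Fin n) // e.ncard = r}

/-- `T` is a copy of `H`: it is the image of `H`, isolated vertices included, under an injection of
the vertex set of `H`. -/
def IsCopy {α β : Type*} (T : Hypergraph β) (H : Hypergraph α) : Prop :=
  ∃ φ : α → β, Set.InjOn φ H.vertexSet ∧ T = H.image φ

/-- The edge-colouring `g` of the complete `r`-graph is rainbow on `T`: no two distinct edges of `T`
get the same colour. -/
def IsRainbow {r n k : ℕ} (g : CompleteEdge r n → Fin k) (T : Hypergraph (Fin n)) : Prop :=
  ∀ e₁ e₂ : CompleteEdge r n, e₁.1 ∈ T.edgeSet → e₂.1 ∈ T.edgeSet → g e₁ = g e₂ → e₁ = e₂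

/-- A collection of `n` edge-colourings of the complete `r`-graph on `n` vertices with `k` colours,
one for each vertex, is an `(n, r, H)`-local colouring if each copy `T` of `H` has a vertex `u`
whose colouring is rainbow on `T`. -/
def IsLocalColoring {α : Type*} {r n k : ℕ} (H : Hypergraph α)
    (f : Fin n → CompleteEdge r n → Fin k) : Prop :=
  ∀ T : Hypergraph (Fin n), IsCopy T H → ∃ u ∈ T.vertexSet, IsRainbow (f u) T

/-- The local rainbow colouring number `C_r(n, H)`: the least number of colours of an
`(n, r, H)`-local colouring. -/
noncomputable def localRainbowNumber {α : Type*} (r n : ℕ) (H : Hypergraph α) : ℕ :=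
  sInf {k : ℕ | ∃ f : Fin n → CompleteEdge r n → Fin k, IsLocalColoring H f}

/-- If `H` has a vertex, then local colourings exist, so the least number of colours is attained. -/
theorem localRainbowNumber_isLeast {α : Type*} (r n : ℕ) (H : Hypergraph α)
    (hne : H.vertexSet.Nonempty) :
    IsLeast {k : ℕ | ∃ f : Fin n → CompleteEdge r n → Fin k, IsLocalColoring H f}
      (localRainbowNumber r n H) := by
  have h : {k : ℕ | ∃ f : Fin n → CompleteEdge r n → Fin k, IsLocalColoring H f}.Nonempty := by
    refine ⟨Nat.card (CompleteEdge r n), fun _ => Finite.equivFin _, ?_⟩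
    rintro T ⟨φ, -, rfl⟩
    obtain ⟨v, hv⟩ := hne
    exact ⟨φ v, Set.mem_image_of_mem φ hv, fun e₁ e₂ _ _ he => (Finite.equivFin _).injective he⟩
  exact ⟨Nat.sInf_mem h, fun k hk => Nat.sInf_le hk⟩

/-- `H` is `F`, possibly with some isolated vertices added (up to isomorphism). -/
def IsWithIsolatedVertices {α β : Type*} (F : Hypergraph β) (H : Hypergraph α) : Prop :=
  ∃ φ : β → α, Set.InjOn φ F.vertexSet ∧ φ '' F.vertexSet ⊆ H.vertexSet ∧
    H.edgeSet = (F.image φ).edgeSet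

/-- The tight path `TP₃` with edges `abc`, `bcd`, `cde`, where `a, …, e` are `0, …, 4`. -/
def TP3 : Hypergraph (Fin 5) where
  vertexSet := Set.univ
  edgeSet := {{0, 1, 2}, {1, 2, 3}, {2, 3, 4}}
  subset_vertexSet_of_mem_edgeSet' := fun _ _ => Set.subset_univ _

/-- The special path `SP₃` with edges `abc`, `bcd`, `def`, where `a, …, f` are `0, …, 5`. -/
def SP3 : Hypergraph (Fin 6) where
  vertexSet := Set.univ
  edgeSet := {{0, 1, 2}, {1, 2, 3}, {3, 4, 5}}
  subset_vertexSet_of_mem_edgeSet' := fun _ _ => Set.subset_univ _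

/-- The loose cycle `LC₃` with edges `abd`, `bce`, `acf`, where `a, …, f` are `0, …, 5`. -/
def LC3 : Hypergraph (Fin 6) where
  vertexSet := Set.univ
  edgeSet := {{0, 1, 3}, {1, 2, 4}, {0, 2, 5}}
  subset_vertexSet_of_mem_edgeSet' := fun _ _ => Set.subset_univ _

/-- The family of the `3`-graphs with at most three edges that are none of `TP₃`, `SP₃`, `LC₃` with
possibly some isolated vertices added. (The `3`-graphs are those that the theorem is about: finite
and `3`-uniform.) -/
def InFamily {α : Type*} (H : Hypergraph α) : Prop :=
  H.edgeSet.ncard ≤ 3 ∧ ¬ IsWithIsolatedVertices TP3 H ∧ ¬ IsWithIsolatedVertices SP3 H ∧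
    ¬ IsWithIsolatedVertices LC3 H

end LocalRainbow

namespace LocalRainbow

/-! An edge `e` has a position relative to a vertex `w` in a linear order: whether `w ∈ e`, and how
many vertices of `e` precede `w`. Both halves of the theorem reduce to one question about `H`: does
every order of its vertices have a vertex that sees all edges in different positions?

If so, let each vertex colour the triples by their position relative to it. There are four positions
for triples that avoid the vertex and three for triples that contain it, hence seven colours
(`localRainbowNumber_le_seven`).

If not, suppose that local colourings with `k` colours are given. Colour each 4-set by the colours
that its members give to certain triples inside it, with `k ^ 8` colours in all. By Ramsey's theorem
there is a set on which the colour of a triple depends only on its position relative to the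
observing vertex (`exists_placement`). Placing `H` there in a bad order makes every vertex see two
edges of the same colour. The Erdős–Rado argument bounds the number of vertices by a triple
exponential in a multiple of `k ^ 16` (`lt_of_isLocalColoring`), so inverting it costs three
logarithms.

The remaining combinatorial fact is that the bad orders exist exactly outside the family
(`exists_separating_vertex`, `exists_ordering_of_not_inFamily`). An ordered hypergraph with few
edges is a sequence of incidence vectors, so this is a finite search: with three edges only `TP3`,
`SP3` and `LC3` have a bad order (`exists_perm_exceptionalVectors`), and any four edges have one
(`exists_perm_allSeeRepeat`). Further edges and isolated vertices do no harm. -/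

/-! ### Ramsey's theorem for tuples, with the Erdős–Rado bound -/

/-- A colouring of tuples is homogeneous on `A` if all increasing tuples in `A` get one colour. -/
def IsHomogeneous {α κ : Type*} [LinearOrder α] {r : ℕ} (c : (Fin r → α) → κ) (A : Finset α) :
    Prop :=
  ∀ x y : Fin r → α, StrictMono x → StrictMono y → (∀ i, x i ∈ A) → (∀ i, y i ∈ A) → c x = c y

/-- The vertices `y` and `y'` cannot be told apart by the increasing tuples in `A` below them. -/
def IsEndHomogeneous {α κ : Type*} [LinearOrder α] {r : ℕ} (c : (Fin (r + 1) → α) → α → κ)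
    (A B : Finset α) : Prop :=
  ∀ t : Fin (r + 1) → α, StrictMono t → (∀ i, t i ∈ A) → ∀ y ∈ B, ∀ y' ∈ B,
    t (Fin.last r) < y → t (Fin.last r) < y' → c t y = c t y'

/-- Greedy step of Erdős–Rado: `A` is the part built so far and `B` the reservoir of candidates
above it. Moving the least element of `B` into `A` creates new tuples, which end in that element;
the reservoir shrinks to a largest class of candidates that these tuples cannot tell apart. -/
theorem exists_isEndHomogeneous_extension {α κ : Type*} [LinearOrder α] [Fintype κ] [Nonempty κ]
    {r : ℕ} (c : (Fin (r + 1) → α) → α → κ) (M i : ℕ) :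
    ∀ A B : Finset α, (∀ a ∈ A, ∀ b ∈ B, a < b) → IsEndHomogeneous c A (A ∪ B) →
      A.card + i ≤ M → (Fintype.card κ ^ M ^ r + 1) ^ i ≤ B.card →
      ∃ A' ⊆ A ∪ B, A'.card = A.card + i ∧ IsEndHomogeneous c A' A' := by
  classical
  induction i with
  | zero =>
    intro A B _ h _ _
    refine ⟨A, Finset.subset_union_left, rfl, fun t ht htA y hy y' hy' => ?_⟩
    exact h t ht htA y (Finset.mem_union_left _ hy) y' (Finset.mem_union_left _ hy')
  | succ i ih =>
    intro A B hAB h hM hB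
    set Q := Fintype.card κ ^ M ^ r with hQ
    have hpos : 0 < (Q + 1) ^ i := by positivity
    have hBne : B.Nonempty := by
      rw [← Finset.card_pos]
      exact lt_of_lt_of_le (by positivity) hB
    set x := B.min' hBne with hx
    have hxB : x ∈ B := B.min'_mem hBne
    have hxlt : ∀ y ∈ B.erase x, x < y := fun y hy =>
      lt_of_le_of_ne (B.min'_le y (Finset.mem_of_mem_erase hy)) (Finset.ne_of_mem_erase hy).symm
    -- Classes are indexed by the colours of all tuples `s` from `A` followed by `x`, increasing or
    -- not, so there are at most `Q` of them; the `+ 1` in `Q + 1` pays for the removal of `x`.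
    have hcard : Fintype.card ((Fin r → A) → κ) * (Q + 1) ^ i ≤ (B.erase x).card := by
      have h1 : Fintype.card ((Fin r → A) → κ) ≤ Q := by
        simp only [Fintype.card_fun, Fintype.card_fin, Fintype.card_coe]
        exact Nat.pow_le_pow_right Fintype.card_pos (Nat.pow_le_pow_left (by omega) r)
      rw [Finset.card_erase_of_mem hxB]
      have h2 := Nat.mul_le_mul_right ((Q + 1) ^ i) h1
      have h3 : (Q + 1) ^ (i + 1) = Q * (Q + 1) ^ i + (Q + 1) ^ i := by ring
      omega
    obtain ⟨col, -, hcol⟩ := Finset.exists_le_card_fiber_of_mul_le_card_of_maps_to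
      (s := B.erase x) (t := (Finset.univ : Finset ((Fin r → A) → κ)))
      (f := fun y s => c (Fin.snoc (α := fun _ => α) (fun j => (s j : α)) x) y)
      (fun _ _ => Finset.mem_univ _) Finset.univ_nonempty (by simpa using hcard)
    set B' := (B.erase x).filter fun y =>
      (fun s : Fin r → A => c (Fin.snoc (α := fun _ => α) (fun j => (s j : α)) x) y) = col with hB'
    have hB'sub : B' ⊆ B.erase x := Finset.filter_subset _ _
    have hxA : x ∉ A := fun hxA => lt_irrefl _ (hAB x hxA x hxB)
    have hsub : insert x A ∪ B' ⊆ A ∪ B := by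
      intro y hy
      simp only [Finset.mem_union, Finset.mem_insert] at hy ⊢
      rcases hy with (rfl | hy) | hy
      · exact Or.inr hxB
      · exact Or.inl hy
      · exact Or.inr (Finset.mem_of_mem_erase (hB'sub hy))
    have hlt' : ∀ a ∈ insert x A, ∀ b ∈ B', a < b := by
      intro a ha b hb
      rcases Finset.mem_insert.1 ha with rfl | ha
      · exact hxlt b (hB'sub hb)
      · exact hAB a ha b (Finset.mem_of_mem_erase (hB'sub hb))
    have hend : IsEndHomogeneous c (insert x A) (insert x A ∪ B') := by
      intro t ht htA y hy y' hy' hty hty'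
      by_cases hlast : t (Fin.last r) = x
      · have hinit : ∀ j : Fin r, t j.castSucc ∈ A := by
          intro j
          refine Finset.mem_of_mem_insert_of_ne (htA _) fun hj => ?_
          exact (ht (Fin.castSucc_lt_last j)).ne (hj.trans hlast.symm)
        have key : ∀ z ∈ insert x A ∪ B', t (Fin.last r) < z →
            c t z = col fun j => ⟨t j.castSucc, hinit j⟩ := by
          intro z hz htz
          rw [hlast] at htz
          have hzB : z ∈ B' := by
            simp only [Finset.mem_union, Finset.mem_insert] at hz
            rcases hz with (rfl | hz) | hz
            · exact absurd htz (lt_irrefl _)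
            · exact absurd htz (hAB z hz x hxB).not_gt
            · exact hz
          rw [← (Finset.mem_filter.1 hzB).2]
          congr 1
          rw [← hlast]
          exact (Fin.snoc_init_self t).symm
        rw [key y hy hty, key y' hy' hty']
      · have htA' : ∀ j, t j ∈ A := by
          intro j
          refine Finset.mem_of_mem_insert_of_ne (htA j) fun hj => ?_
          have h1 : t j ≤ t (Fin.last r) := ht.monotone (Fin.le_last j)
          have h2 := Finset.mem_of_mem_insert_of_ne (htA (Fin.last r)) hlast
          exact (hAB _ h2 x hxB).not_ge (hj ▸ h1)
        exact h t ht htA' y (hsub hy) y' (hsub hy') hty hty'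
    have hM' : (insert x A).card + i ≤ M := by
      rw [Finset.card_insert_of_notMem hxA]
      omega
    obtain ⟨A', hA', hA'card, hA'h⟩ := ih (insert x A) B' hlt' hend hM' hcol
    refine ⟨A', hA'.trans hsub, ?_, hA'h⟩
    rw [hA'card, Finset.card_insert_of_notMem hxA]
    ring

/-- The Erdős–Rado bound for homogeneous `m`-sets for `q`-colourings of `(r + 1)`-tuples. -/
def ramseyBound (q m : ℕ) : ℕ → ℕ
  | 0 => q * m
  | r + 1 => (q ^ (ramseyBound q m r + 1) ^ r + 1) ^ (ramseyBound q m r + 1)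

/-- On an end-homogeneous set the last entry of a tuple is irrelevant, so it may be replaced by the
maximum of the set; this leaves a colouring of shorter tuples for the induction. -/
theorem exists_isHomogeneous {α κ : Type*} [LinearOrder α] [Fintype κ] [Nonempty κ] (m r : ℕ) :
    ∀ (c : (Fin (r + 1) → α) → κ) (S : Finset α), ramseyBound (Fintype.card κ) m r ≤ S.card →
      ∃ A ⊆ S, m ≤ A.card ∧ IsHomogeneous c A := by
  classical
  induction r with
  | zero =>
    intro c S hS
    obtain ⟨col, -, hcol⟩ := Finset.exists_le_card_fiber_of_mul_le_card_of_maps_to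
      (s := S) (t := (Finset.univ : Finset κ)) (f := fun y => c fun _ => y)
      (fun _ _ => Finset.mem_univ _) Finset.univ_nonempty (by simpa [ramseyBound] using hS)
    refine ⟨_, Finset.filter_subset _ _, hcol, fun x y _ _ hx hy => ?_⟩
    have hconst : ∀ x : Fin (0 + 1) → α, x = fun _ => x 0 := fun x => by
      funext i
      congr 1
      exact Fin.ext (by omega)
    have h1 := (Finset.mem_filter.1 (hx 0)).2
    have h2 := (Finset.mem_filter.1 (hy 0)).2
    rw [hconst x, hconst y, h1, h2]
  | succ r ih =>
    intro c S hS
    set N := ramseyBound (Fintype.card κ) m r with hN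
    -- The target size is one more than the induction needs, as the maximum `z` is set aside.
    obtain ⟨A, hAS, hAcard, hA⟩ := exists_isEndHomogeneous_extension
      (fun (t : Fin (r + 1) → α) y => c (Fin.snoc (α := fun _ => α) t y)) (N + 1) (N + 1) ∅ S
      (by simp) (fun t _ ht => absurd (ht 0) (by simp)) (by simp) hS
    simp only [Finset.empty_union, Finset.card_empty, zero_add] at hAS hAcard
    have hne : A.Nonempty := by
      rw [← Finset.card_pos]
      omega
    set z := A.max' hne with hz
    have hzA : z ∈ A := A.max'_mem hne
    obtain ⟨B, hBA, hBcard, hB⟩ := ih (fun t => c (Fin.snoc (α := fun _ => α) t z)) (A.erase z)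
      (by rw [Finset.card_erase_of_mem hzA, hAcard]; rfl)
    refine ⟨B, (hBA.trans (Finset.erase_subset _ _)).trans hAS, hBcard, ?_⟩
    have hlt : ∀ b ∈ B, b < z := fun b hb =>
      lt_of_le_of_ne (A.le_max' b (Finset.mem_of_mem_erase (hBA hb)))
        (Finset.ne_of_mem_erase (hBA hb))
    have key : ∀ x : Fin (r + 1 + 1) → α, StrictMono x → (∀ i, x i ∈ B) →
        c x = c (Fin.snoc (α := fun _ => α) (fun i => x i.castSucc) z) := by
      intro x hx hxB
      have h1 : c x = c (Fin.snoc (α := fun _ => α) (fun i => x i.castSucc) (x (Fin.last _))) := by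
        congr 1
        exact (Fin.snoc_init_self x).symm
      rw [h1]
      refine hA _ (hx.comp (Fin.strictMono_castSucc)) (fun i => ?_) _ ?_ z hzA ?_ ?_
      · exact Finset.mem_of_mem_erase (hBA (hxB _))
      · exact Finset.mem_of_mem_erase (hBA (hxB _))
      · exact hx (Fin.castSucc_lt_last _)
      · exact hlt _ (hxB _)
    intro x y hx hy hxB hyB
    rw [key x hx hxB, key y hy hyB]
    exact hB _ _ (hx.comp Fin.strictMono_castSucc) (hy.comp Fin.strictMono_castSucc)
      (fun i => hxB _) (fun i => hyB _)

/-- Each step up in `r` adds one exponential, and lower-order terms are absorbed into the constants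
2, 8 and 12 of the top exponent. What matters later is that this exponent is quadratic in `q`: with
`q = k ^ 8` it yields `k ^ 16`. -/
theorem ramseyBound_three_le (q m : ℕ) (hq : 1 ≤ q) :
    ramseyBound q m 3 ≤ 2 ^ 2 ^ 2 ^ (12 * (q * (q * m + 1))) := by
  have hq2 : q ≤ 2 ^ q := Nat.lt_two_pow_self.le
  have hq3 : q + 1 ≤ 2 ^ q := Nat.lt_two_pow_self
  have step : ∀ a e : ℕ, 1 ≤ a → (q ^ e + 1) ^ a ≤ 2 ^ ((q * e + 1) * a) := by
    intro a e _
    rw [pow_mul]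
    refine Nat.pow_le_pow_left ?_ a
    have h1 : q ^ e ≤ 2 ^ (q * e) := by
      rw [pow_mul]
      exact Nat.pow_le_pow_left hq2 e
    have h2 : 1 ≤ 2 ^ (q * e) := Nat.one_le_two_pow
    rw [pow_succ]
    omega
  have succ_le : ∀ x : ℕ, 2 ^ x + 1 ≤ 2 ^ (x + 1) := by
    intro x
    have h2 : 1 ≤ 2 ^ x := Nat.one_le_two_pow
    rw [pow_succ]
    omega
  set K := q * m + 1 with hK
  have hK1 : 1 ≤ K := by omega
  have hqK : 1 ≤ q * K := Nat.mul_pos hq hK1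
  have hqqK : q ≤ q * K := Nat.le_mul_of_pos_right q hK1
  set a := ramseyBound q m 1 + 1 with ha
  have ha2 : a ≤ 2 ^ (2 * (q * K)) := by
    have h1 : ramseyBound q m 1 ≤ 2 ^ (q * K) := by
      rw [pow_mul]
      simpa [ramseyBound] using Nat.pow_le_pow_left hq3 K
    exact (Nat.succ_le_succ h1).trans ((succ_le _).trans (Nat.pow_le_pow_right two_pos (by omega)))
  set b := ramseyBound q m 2 + 1 with hb
  have hb2 : b ≤ 2 ^ 2 ^ (8 * (q * K)) := by
    have h1 : ramseyBound q m 2 ≤ 2 ^ ((q * a + 1) * a) := by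
      simpa [ramseyBound, ha] using step a a (by omega)
    refine (Nat.succ_le_succ h1).trans ((succ_le _).trans (Nat.pow_le_pow_right two_pos ?_))
    have h2 : (q * a + 1) * a + 1 ≤ 2 ^ 2 * q * a ^ 2 := by
      have h3 : 1 ≤ q * a ^ 2 := Nat.mul_pos hq (by positivity)
      have h4 : a ≤ q * a ^ 2 := by
        calc a = 1 * a ^ 1 := by ring
          _ ≤ q * a ^ 2 := Nat.mul_le_mul hq (Nat.pow_le_pow_right (by omega) (by norm_num))
      nlinarith
    refine h2.trans ((Nat.mul_le_mul (Nat.mul_le_mul_left _ hq2) (Nat.pow_le_pow_left ha2 2)).trans ?_)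
    rw [← pow_mul, ← pow_add, ← pow_add]
    exact Nat.pow_le_pow_right two_pos (by omega)
  have h1 : ramseyBound q m 3 ≤ 2 ^ ((q * b ^ 2 + 1) * b) := by
    simpa [ramseyBound, hb] using step b (b ^ 2) (by omega)
  refine h1.trans (Nat.pow_le_pow_right two_pos ?_)
  have h2 : (q * b ^ 2 + 1) * b ≤ 2 ^ 1 * q * b ^ 3 := by
    have : b ≤ q * b ^ 3 := by
      calc b = 1 * b ^ 1 := by ring
        _ ≤ q * b ^ 3 := Nat.mul_le_mul hq (Nat.pow_le_pow_right (by omega) (by norm_num))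
    nlinarith
  refine h2.trans ((Nat.mul_le_mul (Nat.mul_le_mul_left _ hq2) (Nat.pow_le_pow_left hb2 3)).trans ?_)
  rw [← pow_mul, ← pow_add, ← pow_add]
  refine Nat.pow_le_pow_right two_pos ?_
  have h3 : 1 + q ≤ 2 ^ (8 * (q * K)) := by
    rw [add_comm]
    exact hq3.trans (Nat.pow_le_pow_right two_pos (by omega))
  calc 1 + q + 2 ^ (8 * (q * K)) * 3 ≤ 2 ^ (8 * (q * K)) * 2 ^ 2 := by omega
    _ ≤ 2 ^ (12 * (q * K)) := by
      rw [← pow_add]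
      exact Nat.pow_le_pow_right two_pos (by omega)

/-! ### Ordered hypergraphs as sequences of incidence vectors -/

/-- A list of numbers has a repetition. -/
def hasRepeat : List ℕ → Bool
  | [] => false
  | a :: l => l.any (Nat.beq a) || hasRepeat l

theorem hasRepeat_eq_false_iff {l : List ℕ} : hasRepeat l = false ↔ l.Nodup := by
  induction l with
  | nil => simp [hasRepeat]
  | cons a l ih =>
    rw [hasRepeat, Bool.or_eq_false_iff, ih, List.nodup_cons, List.any_eq_false]
    simp only [Nat.beq_eq]
    exact and_congr_left fun _ => ⟨fun h ha => h a ha rfl, fun h x hx hax => h (hax ▸ hx)⟩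

/-- A vertex with incidence vector `S`, preceded by `st i` vertices of the `i`-th edge, sees two
edges in the same relative position. -/
def seesRepeat (st : List ℕ) (S : List Bool) : Bool :=
  hasRepeat (st.zipWith (fun n b => 2 * n + b.toNat) S)

/-- The number of vertices of each edge passed, after one more vertex with incidence vector `S`. -/
def advance (st : List ℕ) (S : List Bool) : List ℕ :=
  st.zipWith (fun n b => n + b.toNat) S

/-- All vertices of a sequence of incidence vectors see two edges in the same relative position. -/
def allSeeRepeat : List ℕ → List (List Bool) → Bool
  | _, [] => true
  | st, S :: L => seesRepeat st S && allSeeRepeat (advance st S) L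

/-- The size of the `i`-th edge. -/
def edgeSize (L : List (List Bool)) (i : ℕ) : ℕ :=
  L.countP fun S => S.getD i false

/-- The edges have three vertices each, and none contains another. -/
def isThreeGraph (r : ℕ) (L : List (List Bool)) : Bool :=
  (List.range r).all fun i => decide (edgeSize L i = 3) &&
    (List.range r).all fun j => decide (i = j) || L.any fun S => S.getD i false && !S.getD j false

theorem isThreeGraph_iff {r : ℕ} {L : List (List Bool)} :
    isThreeGraph r L = true ↔ ∀ i < r, edgeSize L i = 3 ∧
      ∀ j < r, i ≠ j → ∃ S ∈ L, S.getD i false = true ∧ S.getD j false = false := by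
  simp only [isThreeGraph, List.all_eq_true, List.mem_range, Bool.and_eq_true, decide_eq_true_eq,
    Bool.or_eq_true, List.any_eq_true, Bool.not_eq_true', or_iff_not_imp_left, ne_eq]

theorem isThreeGraph_perm {r : ℕ} {L M : List (List Bool)} (h : L.Perm M) :
    isThreeGraph r L = isThreeGraph r M := by
  rw [Bool.eq_iff_iff, isThreeGraph_iff, isThreeGraph_iff]
  simp only [edgeSize, h.countP_eq, h.mem_iff]

/-- The sizes of the first `r` edges. -/
def edgeSizes (r : ℕ) (L : List (List Bool)) : List ℕ :=
  (List.range r).map (edgeSize L)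

theorem advance_edgeSizes {r : ℕ} {S : List Bool} (L : List (List Bool)) (hS : S.length = r) :
    advance (edgeSizes r L) S = edgeSizes r (S :: L) := by
  apply List.ext_getElem
  · simp [advance, edgeSizes, hS]
  · intro i h1 h2
    have hi : i < S.length := by
      simp only [advance, List.length_zipWith, lt_inf_iff] at h1
      exact h1.2
    simp only [advance, edgeSizes, List.getElem_zipWith, List.getElem_map, List.getElem_range,
      edgeSize, List.countP_cons, List.getD_eq_getElem _ _ hi]
    cases S[i] <;> simp

theorem edgeSizes_eq_of_isThreeGraph {r : ℕ} {L : List (List Bool)}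
    (h : isThreeGraph r L = true) : edgeSizes r L = List.replicate r 3 := by
  rw [isThreeGraph_iff] at h
  refine List.eq_replicate_iff.2 ⟨by simp [edgeSizes], fun n hn => ?_⟩
  obtain ⟨i, hi, rfl⟩ := List.mem_map.1 hn
  exact (h i (List.mem_range.1 hi)).1

/-- The edges have at most three vertices. -/
def sizesLeThree (st : List ℕ) : Bool :=
  st.all fun n => Nat.ble n 3

theorem sizesLeThree_of_sublist {r : ℕ} {L M : List (List Bool)} (h : isThreeGraph r M = true)
    (hs : L.Sublist M) : sizesLeThree (edgeSizes r L) = true := by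
  rw [isThreeGraph_iff] at h
  simp only [sizesLeThree, edgeSizes, List.all_eq_true, List.mem_map, List.mem_range, Nat.ble_eq]
  rintro _ ⟨i, hi, rfl⟩
  exact (hs.countP_le).trans (h i hi).1.le

/-- All incidence vectors for `r` edges. -/
def incidenceVectors : ℕ → List (List Bool)
  | 0 => [[]]
  | r + 1 => (incidenceVectors r).flatMap fun S => [true :: S, false :: S]

theorem mem_incidenceVectors {r : ℕ} {S : List Bool} (h : S.length = r) :
    S ∈ incidenceVectors r := by
  induction r generalizing S with
  | zero => simp [List.length_eq_zero_iff.1 h, incidenceVectors]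
  | succ r ih =>
    cases S with
    | nil => simp at h
    | cons b S =>
      simp only [incidenceVectors, List.mem_flatMap]
      refine ⟨S, ih (by simpa using h), ?_⟩
      cases b <;> simp

/-- The incidence vectors of the vertices of at least one of three edges. -/
def nonzeroVectorsThree : List (List Bool) :=
  [[true, true, true], [true, true, false], [true, false, true], [false, true, true],
    [true, false, false], [false, true, false], [false, false, true]]

/-- The incidence vectors of the vertices of exactly one of four edges. -/
def singleVectors : List (List Bool) :=
  [[true, false, false, false], [false, true, false, false], [false, false, true, false],
    [false, false, false, true]]

/-- The incidence vectors of the vertices of at least two of four edges. -/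
def multipleVectors : List (List Bool) :=
  [[true, true, true, true], [true, true, true, false], [true, true, false, true],
    [true, false, true, true], [false, true, true, true], [true, true, false, false],
    [true, false, true, false], [true, false, false, true], [false, true, true, false],
    [false, true, false, true], [false, false, true, true]]

theorem mem_nonzeroVectorsThree {S : List Bool} (h : S.length = 3) (hS : true ∈ S) :
    S ∈ nonzeroVectorsThree :=
  (show ∀ S ∈ incidenceVectors 3, true ∈ S → S ∈ nonzeroVectorsThree by decide) S
    (mem_incidenceVectors h) hS

theorem mem_multipleVectors_or_mem_singleVectors {S : List Bool} (h : S.length = 4)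
    (hS : true ∈ S) : S ∈ multipleVectors ∨ S ∈ singleVectors :=
  (show ∀ S ∈ incidenceVectors 4, true ∈ S → S ∈ multipleVectors ∨ S ∈ singleVectors by decide) S
    (mem_incidenceVectors h) hS

/-! ### The search over three edges -/

/-- The incidence vectors of `LC₃`, `TP₃` and `SP₃`, for the different orders of the edges. -/
def exceptionalVectors : List (List (List Bool)) :=
  let a := [true, false, false]
  let b := [false, true, false]
  let c := [false, false, true]
  let ab := [true, true, false]
  let ac := [true, false, true]
  let bc := [false, true, true]
  let abc := [true, true, true]
  [[ac, ab, bc, a, b, c],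
    [a, ab, abc, bc, c], [a, ac, abc, bc, b], [b, ab, abc, ac, c],
    [a, ab, ab, bc, c, c], [a, ac, ac, bc, b, b], [b, ab, ab, ac, c, c],
    [b, bc, bc, ac, a, a], [c, ac, ac, ab, b, b], [c, bc, bc, ab, a, a]]

/-- Check that the sequences of incidence vectors of three edges of which all vertices see two edges
in the same relative position, extending the reverse of `acc` by at most `n` vectors, are
exceptional. Here `st` holds the edge sizes in `acc`. -/
def checkThree : ℕ → List ℕ → List (List Bool) → Bool
  | 0, _, _ => false
  | n + 1, st, acc =>
    if st = [3, 3, 3] then !isThreeGraph 3 acc || exceptionalVectors.any fun C => acc.isPerm C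
    else nonzeroVectorsThree.all fun S => !seesRepeat st S || !sizesLeThree (advance st S) ||
      checkThree n (advance st S) (S :: acc)

/-- The search may stop once all sizes are three, since any further nonzero vector would make an
edge too large. Distinctness of the edges is tested only there: two equal edges are in the same
position everywhere, so such sequences pass the search and have to be discarded. -/
theorem checkThree_sound (n : ℕ) : ∀ acc L : List (List Bool),
    checkThree n (edgeSizes 3 acc) acc = true → (∀ S ∈ L, S ∈ nonzeroVectorsThree) →
    allSeeRepeat (edgeSizes 3 acc) L = true → isThreeGraph 3 (L.reverse ++ acc) = true →
    ∃ C ∈ exceptionalVectors, (L.reverse ++ acc).Perm C := by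
  have hvec : ∀ S ∈ nonzeroVectorsThree, S.length = 3 ∧ true ∈ S := by decide
  induction n with
  | zero =>
    intro acc L h
    simp [checkThree] at h
  | succ n ih =>
    intro acc L h hmem hall h3
    rw [checkThree] at h
    cases L with
    | nil =>
      rw [List.reverse_nil, List.nil_append] at h3 ⊢
      have h4 : edgeSizes 3 acc = [3, 3, 3] := edgeSizes_eq_of_isThreeGraph h3
      rw [if_pos h4, h3] at h
      simpa [List.any_eq_true, List.isPerm_iff] using h
    | cons S L =>
      obtain ⟨hlen, htrue⟩ := hvec S (hmem S List.mem_cons_self)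
      have hrev : (S :: L).reverse ++ acc = L.reverse ++ (S :: acc) := by simp
      rw [hrev] at h3 ⊢
      have hle := sizesLeThree_of_sublist h3 (List.sublist_append_right _ _)
      rw [if_neg] at h
      · rw [allSeeRepeat, Bool.and_eq_true, advance_edgeSizes acc hlen] at hall
        have h1 := List.all_eq_true.1 h S (hmem S List.mem_cons_self)
        rw [advance_edgeSizes acc hlen, hle, hall.1] at h1
        exact ih _ L (by simpa using h1) (fun T hT => hmem T (List.mem_cons_of_mem _ hT)) hall.2 h3
      · intro hst
        rw [← advance_edgeSizes acc hlen, hst] at hle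
        exact absurd hle ((show ∀ S ∈ nonzeroVectorsThree,
          ¬ sizesLeThree (advance [3, 3, 3] S) = true by decide) S (hmem S List.mem_cons_self))

/-- Three triples have at most nine vertices; the tenth level is the call that recognises a complete
sequence. -/
theorem checkThree_eq_true : checkThree 10 [0, 0, 0] [] = true := by
  decide +kernel

/-- Three edges of size three whose vertices are ordered such that all vertices see two edges in the
same relative position form an exceptional hypergraph. -/
theorem exists_perm_exceptionalVectors {L : List (List Bool)}
    (hmem : ∀ S ∈ L, true ∈ S ∧ S.length = 3) (hall : allSeeRepeat [0, 0, 0] L = true)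
    (h3 : isThreeGraph 3 L = true) : ∃ C ∈ exceptionalVectors, L.Perm C := by
  obtain ⟨C, hC, h⟩ := checkThree_sound 10 [] L checkThree_eq_true
    (fun S hS => mem_nonzeroVectorsThree (hmem S hS).2 (hmem S hS).1) hall
    (by rwa [List.append_nil, isThreeGraph_perm L.reverse_perm])
  rw [List.append_nil] at h
  exact ⟨C, hC, L.reverse_perm.symm.trans h⟩

/-! ### The search over four edges -/

/-- The ways to pick an element of a list, with the remaining elements. -/
def picks {α : Type*} : List α → List (α × List α)
  | [] => []
  | a :: l => (a, l) :: (picks l).map fun p => (p.1, a :: p.2)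

theorem perm_of_mem_picks {α : Type*} {l : List α} {p : α × List α} (h : p ∈ picks l) :
    (p.1 :: p.2).Perm l := by
  induction l generalizing p with
  | nil => simp [picks] at h
  | cons a l ih =>
    rw [picks, List.mem_cons, List.mem_map] at h
    obtain rfl | ⟨q, hq, rfl⟩ := h
    · exact List.Perm.refl _
    · exact (List.Perm.swap _ _ _).trans ((ih hq).cons a)

/-- Search for an arrangement of `M` in which all vertices see two edges in the same relative
position. -/
def isArrangeable : ℕ → List ℕ → List (List Bool) → Bool
  | _, _, [] => true
  | 0, _, _ :: _ => false
  | n + 1, st, M@(_ :: _) =>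
    (picks M).any fun p => seesRepeat st p.1 && isArrangeable n (advance st p.1) p.2

theorem isArrangeable_sound (n : ℕ) : ∀ (st : List ℕ) (M : List (List Bool)),
    isArrangeable n st M = true →
    ∃ L : List (List Bool), L.Perm M ∧ allSeeRepeat st L = true := by
  induction n with
  | zero =>
    intro st M h
    cases M with
    | nil => exact ⟨[], List.Perm.refl _, rfl⟩
    | cons S M => simp [isArrangeable] at h
  | succ n ih =>
    intro st M h
    cases M with
    | nil => exact ⟨[], List.Perm.refl _, rfl⟩
    | cons S M =>
      rw [isArrangeable, List.any_eq_true] at h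
      obtain ⟨p, hp, h⟩ := h
      rw [Bool.and_eq_true] at h
      obtain ⟨L, hL, hall⟩ := ih _ _ h.2
      exact ⟨p.1 :: L, (hL.cons _).trans (perm_of_mem_picks hp), by
        rw [allSeeRepeat, h.1, hall, Bool.and_self]⟩

/-- Complete edges of the given sizes to size three by vertices in one edge each. -/
def completion : List ℕ → List (List Bool)
  | [a, b, c, d] => List.replicate (3 - a) [true, false, false, false] ++
    (List.replicate (3 - b) [false, true, false, false] ++
    (List.replicate (3 - c) [false, false, true, false] ++
    List.replicate (3 - d) [false, false, false, true]))
  | _ => []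

/-- A vertex in one edge only is counted by that edge alone, so the missing sizes determine how many
such vertices of each kind there are. The search therefore branches only over vertices in several
edges. -/
theorem perm_completion {acc M : List (List Bool)} (hM : ∀ S ∈ M, S ∈ singleVectors)
    (h3 : edgeSizes 4 (M ++ acc) = [3, 3, 3, 3]) : M.Perm (completion (edgeSizes 4 acc)) := by
  have h4 : ∀ i < 4, edgeSize M i = 3 - edgeSize acc i := by
    intro i hi
    have h5 : edgeSize (M ++ acc) i = 3 := by
      have : edgeSize (M ++ acc) i ∈ edgeSizes 4 (M ++ acc) :=
        List.mem_map_of_mem (List.mem_range.2 hi)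
      rw [h3] at this
      simpa using this
    have h6 : edgeSize (M ++ acc) i = edgeSize M i + edgeSize acc i := List.countP_append
    omega
  have hcount : ∀ i < 4, ∀ T : List Bool,
      (∀ S ∈ singleVectors, (S == T) = S.getD i false) → M.count T = edgeSize M i := by
    intro i _ T hT
    exact List.countP_congr fun S hS => by rw [hT S (hM S hS)]
  have hst : edgeSizes 4 acc = [edgeSize acc 0, edgeSize acc 1, edgeSize acc 2, edgeSize acc 3] :=
    rfl
  rw [hst, completion, ← h4 0 (by decide), ← h4 1 (by decide), ← h4 2 (by decide),
    ← h4 3 (by decide), List.perm_iff_count]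
  intro T
  by_cases hT : T ∈ singleVectors
  · simp only [singleVectors, List.mem_cons, List.not_mem_nil, or_false] at hT
    simp only [List.count_append, List.count_replicate]
    rcases hT with rfl | rfl | rfl | rfl
    · simpa using hcount 0 (by decide) _ (by decide)
    · simpa using hcount 1 (by decide) _ (by decide)
    · simpa using hcount 2 (by decide) _ (by decide)
    · simpa using hcount 3 (by decide) _ (by decide)
  · rw [List.count_eq_zero_of_not_mem fun h => hT (hM T h)]
    simp only [singleVectors, List.mem_cons, List.not_mem_nil, or_false, not_or] at hT
    simp [List.count_append, List.count_replicate, Ne.symm hT.1, Ne.symm hT.2.1,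
      Ne.symm hT.2.2.1, Ne.symm hT.2.2.2]

/-- Check that the multisets of incidence vectors of four edges of size three that extend `acc` by
vectors in the given list and by vertices in one edge each have an arrangement in which all vertices
see two edges in the same relative position. Here `st` holds the edge sizes in `acc`. -/
def checkFour : ℕ → List (List Bool) → List ℕ → List (List Bool) → Bool
  | 0, _, _, _ => false
  | _ + 1, [], st, acc => isArrangeable 12 [0, 0, 0, 0] (acc ++ completion st)
  | n + 1, S :: Ss, st, acc => checkFour n Ss st acc &&
    (!sizesLeThree (advance st S) || checkFour n (S :: Ss) (advance st S) (S :: acc))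

/-- The two branches decide whether the first vector still occurs in the rest `M` of the multiset;
if not, it is dropped from the list for good. Equal edges need no exclusion here, since they only
make a bad arrangement easier to find. -/
theorem checkFour_sound (n : ℕ) : ∀ Ss acc M : List (List Bool),
    checkFour n Ss (edgeSizes 4 acc) acc = true → (∀ S ∈ Ss, S.length = 4) →
    (∀ S ∈ M, S ∈ Ss ∨ S ∈ singleVectors) → isThreeGraph 4 (M ++ acc) = true →
    ∃ L : List (List Bool), L.Perm (M ++ acc) ∧ allSeeRepeat [0, 0, 0, 0] L = true := by
  induction n with
  | zero =>
    intro Ss acc M h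
    simp [checkFour] at h
  | succ n ih =>
    intro Ss acc M h hSs hM h3
    cases Ss with
    | nil =>
      obtain ⟨L, hL, hall⟩ := isArrangeable_sound _ _ _ h
      have hM' := perm_completion (fun S hS => (hM S hS).resolve_left List.not_mem_nil)
        (edgeSizes_eq_of_isThreeGraph h3)
      exact ⟨L, hL.trans (List.perm_append_comm.trans (hM'.symm.append_right acc)), hall⟩
    | cons S Ss =>
      rw [checkFour, Bool.and_eq_true] at h
      by_cases hS : S ∈ M
      · have hperm : (M.erase S ++ (S :: acc)).Perm (M ++ acc) :=
          List.perm_middle.trans ((List.perm_cons_erase hS).symm.append_right acc)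
        have h3' := h3
        rw [← isThreeGraph_perm hperm] at h3'
        have h1 := h.2
        rw [advance_edgeSizes acc (hSs S List.mem_cons_self),
          sizesLeThree_of_sublist h3' (List.sublist_append_right _ _)] at h1
        obtain ⟨L, hL, hall⟩ := ih (S :: Ss) _ (M.erase S) (by simpa using h1) hSs
          (fun T hT => hM T (List.mem_of_mem_erase hT)) h3'
        exact ⟨L, hL.trans hperm, hall⟩
      · refine ih Ss acc M h.1 (fun T hT => hSs T (List.mem_cons_of_mem _ hT)) (fun T hT => ?_) h3
        refine (hM T hT).imp_left (List.mem_of_ne_of_mem ?_)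
        rintro rfl
        exact hS hT

/-- Ample depth: at most eleven vectors are dropped, at most six are added because each uses two of
the twelve incidences, and one call ends the branch. -/
theorem checkFour_eq_true : checkFour 24 multipleVectors [0, 0, 0, 0] [] = true := by
  decide +kernel

/-- The vertices of four edges of size three can be arranged such that all vertices see two edges in
the same relative position. -/
theorem exists_perm_allSeeRepeat {M : List (List Bool)}
    (hM : ∀ S ∈ M, true ∈ S ∧ S.length = 4) (h3 : isThreeGraph 4 M = true) :
    ∃ L : List (List Bool), L.Perm M ∧ allSeeRepeat [0, 0, 0, 0] L = true := by
  have := checkFour_sound 24 multipleVectors [] M checkFour_eq_true (by decide)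
    (fun S hS => mem_multipleVectors_or_mem_singleVectors (hM S hS).2 (hM S hS).1)
    (by rwa [List.append_nil])
  rwa [List.append_nil] at this

/-! ### Translation between orderings of vertices and sequences of vectors -/

/-- The number of vertices of `e` that come before `w` in the ordering by `g`. -/
noncomputable def numBelow {α : Type*} (g : α → ℕ) (e : Set α) (w : α) : ℕ :=
  {v | v ∈ e ∧ g v < g w}.ncard

/-- The edges `e` and `e'` are in the same position relative to `w` in the ordering by `g`. -/
def SamePosition {α : Type*} (g : α → ℕ) (w : α) (e e' : Set α) : Prop :=
  (w ∈ e ↔ w ∈ e') ∧ numBelow g e w = numBelow g e' w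

open Classical in
/-- The incidence vector of a vertex. -/
noncomputable def incidence {α : Type*} (es : List (Set α)) (v : α) : List Bool :=
  es.map fun e => decide (v ∈ e)

open Classical in
/-- The position of the edges relative to `w` in the ordering by `g`, encoded by numbers. -/
noncomputable def positions {α : Type*} (g : α → ℕ) (es : List (Set α)) (w : α) : List ℕ :=
  es.map fun e => 2 * numBelow g e w + (decide (w ∈ e)).toNat

theorem length_incidence {α : Type*} (es : List (Set α)) (v : α) :
    (incidence es v).length = es.length :=
  List.length_map _

open Classical in
theorem getD_incidence {α : Type*} {es : List (Set α)} {i : ℕ} (hi : i < es.length) (v : α) :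
    (incidence es v).getD i false = decide (v ∈ es[i]) := by
  rw [List.getD_eq_getElem _ _ (by rwa [length_incidence])]
  simp [incidence]

theorem true_mem_incidence {α : Type*} {es : List (Set α)} {v : α} :
    true ∈ incidence es v ↔ ∃ e ∈ es, v ∈ e := by
  simp [incidence]

open Classical in
theorem position_eq_iff {α : Type*} {g : α → ℕ} {w : α} {e e' : Set α} :
    2 * numBelow g e w + (decide (w ∈ e)).toNat = 2 * numBelow g e' w + (decide (w ∈ e')).toNat ↔
      SamePosition g w e e' := by
  unfold SamePosition
  by_cases h : w ∈ e <;> by_cases h' : w ∈ e' <;> simp [h, h'] <;> omega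

theorem hasRepeat_positions {α : Type*} {g : α → ℕ} {es : List (Set α)} {w : α} (hes : es.Nodup) :
    hasRepeat (positions g es w) = true ↔ ∃ e ∈ es, ∃ e' ∈ es, e ≠ e' ∧ SamePosition g w e e' := by
  rw [← not_iff_not, Bool.not_eq_true, hasRepeat_eq_false_iff, positions, List.nodup_map_iff_inj_on hes]
  push Not
  constructor
  · intro h e he e' he' hne hs
    exact hne (h e he e' he' (position_eq_iff.2 hs))
  · intro h e he e' he' heq
    by_contra hne
    exact h e he e' he' hne (position_eq_iff.1 heq)

open Classical in
theorem ncard_setOf_mem_list {α : Type*} {l : List α} (hl : l.Nodup) (e : Set α) :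
    {v | v ∈ e ∧ v ∈ l}.ncard = l.countP fun v => decide (v ∈ e) := by
  have : {v | v ∈ e ∧ v ∈ l} = ((l.filter fun v => decide (v ∈ e)).toFinset : Set α) := by
    ext v
    simp [and_comm]
  rw [this, Set.ncard_coe_finset, List.toFinset_card_of_nodup (hl.filter _),
    List.countP_eq_length_filter]

-- The prefix `l₀` is general for the sake of the induction: the running state of `allSeeRepeat` is
-- the number of vertices of each edge met so far.
open Classical in
theorem allSeeRepeat_iff {α : Type*} (es : List (Set α)) (l : List α) : ∀ l₀ : List α,
    allSeeRepeat (es.map fun e => l₀.countP fun v => decide (v ∈ e)) (l.map (incidence es)) = true ↔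
      ∀ x u y, l = x ++ u :: y → hasRepeat (es.map fun e =>
        2 * ((l₀ ++ x).countP fun v => decide (v ∈ e)) + (decide (u ∈ e)).toNat) = true := by
  induction l with
  | nil =>
    intro l₀
    simp [allSeeRepeat]
  | cons w l ih =>
    intro l₀
    have h1 : seesRepeat (es.map fun e => l₀.countP fun v => decide (v ∈ e)) (incidence es w) =
        hasRepeat (es.map fun e =>
          2 * (l₀.countP fun v => decide (v ∈ e)) + (decide (w ∈ e)).toNat) := by
      rw [seesRepeat, incidence, List.zipWith_map, List.zipWith_self]
    have h2 : advance (es.map fun e => l₀.countP fun v => decide (v ∈ e)) (incidence es w) =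
        es.map fun e => (l₀ ++ [w]).countP fun v => decide (v ∈ e) := by
      rw [advance, incidence, List.zipWith_map, List.zipWith_self]
      refine List.map_congr_left fun e _ => ?_
      by_cases hw : w ∈ e <;> simp [hw]
    rw [List.map_cons, allSeeRepeat, Bool.and_eq_true, h1, h2, ih]
    constructor
    · rintro ⟨h3, h4⟩ x u y hxy
      cases x with
      | nil =>
        rw [List.nil_append, List.cons.injEq] at hxy
        rw [List.append_nil, ← hxy.1]
        exact h3
      | cons a x =>
        rw [List.cons_append, List.cons.injEq] at hxy
        have := h4 x u y hxy.2
        rwa [List.append_assoc, List.singleton_append, hxy.1] at this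
    · intro h
      refine ⟨?_, fun x u y hxy => ?_⟩
      · simpa only [List.append_nil] using h [] w l rfl
      · have := h (w :: x) u y (by rw [hxy, List.cons_append])
        rwa [List.append_assoc, List.singleton_append]

theorem setOf_lt_eq_setOf_mem {α : Type*} {g : α → ℕ} {e : Set α} {x y : List α} {u : α}
    (hl : (x ++ u :: y).Pairwise (g · < g ·)) (he : ∀ v ∈ e, v ∈ x ++ u :: y) :
    {v | v ∈ e ∧ g v < g u} = {v | v ∈ e ∧ v ∈ x} := by
  rw [List.pairwise_append, List.pairwise_cons] at hl
  ext v
  simp only [Set.mem_ofPred_eq]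
  refine and_congr_right fun hv => ⟨fun hlt => ?_, fun hx => hl.2.2 v hx u List.mem_cons_self⟩
  have := he v hv
  rw [List.mem_append, List.mem_cons] at this
  rcases this with h | rfl | h
  · exact h
  · exact absurd hlt (lt_irrefl _)
  · exact absurd hlt (hl.2.1.1 v h).not_gt

theorem nodup_of_pairwise_lt {α : Type*} {g : α → ℕ} {l : List α} (hl : l.Pairwise (g · < g ·)) :
    l.Nodup :=
  hl.imp fun h heq => by
    rw [heq] at h
    exact lt_irrefl _ h

theorem allSeeRepeat_iff_of_pairwise {α : Type*} {g : α → ℕ} {es : List (Set α)} {l : List α}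
    (hl : l.Pairwise (g · < g ·)) (hes : ∀ e ∈ es, ∀ v ∈ e, v ∈ l) :
    allSeeRepeat (List.replicate es.length 0) (l.map (incidence es)) = true ↔
      ∀ w ∈ l, hasRepeat (positions g es w) = true := by
  classical
  have h0 : List.replicate es.length 0 =
      es.map fun e => ([] : List α).countP fun v => decide (v ∈ e) := by
    simp
  have key : ∀ x u y, l = x ++ u :: y → (es.map fun e =>
      2 * (([] ++ x).countP fun v => decide (v ∈ e)) + (decide (u ∈ e)).toNat) =
        positions g es u := by
    rintro x u y rfl
    refine List.map_congr_left fun e he => ?_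
    rw [numBelow, setOf_lt_eq_setOf_mem hl (hes e he), List.nil_append,
      ncard_setOf_mem_list (List.nodup_append.1 (nodup_of_pairwise_lt hl)).1]
  rw [h0]
  convert allSeeRepeat_iff es l [] using 1
  constructor
  · intro h x u y hxy
    have := h u (by simp [hxy])
    rw [← key x u y hxy] at this
    convert this
  · intro h w hw
    obtain ⟨x, y, hxy⟩ := List.append_of_mem hw
    have := h x w y hxy
    rw [← key x w y hxy]
    convert this

theorem isThreeGraph_map_incidence {α : Type*} {es : List (Set α)} {l : List α} (hes : es.Nodup)
    (hl : l.Nodup) (hsub : ∀ e ∈ es, ∀ v ∈ e, v ∈ l) (h3 : ∀ e ∈ es, e.ncard = 3) :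
    isThreeGraph es.length (l.map (incidence es)) = true := by
  classical
  rw [isThreeGraph_iff]
  intro i hi
  constructor
  · rw [edgeSize, List.countP_map, ← h3 _ (List.getElem_mem hi)]
    have h1 : es[i] = {v | v ∈ es[i] ∧ v ∈ l} := by
      ext v
      exact ⟨fun h => ⟨h, hsub _ (List.getElem_mem hi) v h⟩, fun h => h.1⟩
    rw [h1, ncard_setOf_mem_list hl]
    refine List.countP_congr fun v hv => ?_
    rw [Function.comp_apply, getD_incidence hi]
  · intro j hj hij
    have hne : es[i] ≠ es[j] := fun h => hij ((List.Nodup.getElem_inj_iff hes).1 h)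
    obtain ⟨v, hvi, hvj⟩ : ∃ v ∈ es[i], v ∉ es[j] := by
      by_contra! h
      have hfin : es[j].Finite := Set.finite_of_ncard_ne_zero (by
        rw [h3 _ (List.getElem_mem hj)]
        norm_num)
      exact hne (Set.eq_of_subset_of_ncard_le h (by
        rw [h3 _ (List.getElem_mem hi), h3 _ (List.getElem_mem hj)]) hfin)
    refine ⟨_, List.mem_map_of_mem (hsub _ (List.getElem_mem hi) v hvi), ?_, ?_⟩
    · rw [getD_incidence hi]
      simpa using hvi
    · rw [getD_incidence hj]
      simpa using hvj

theorem exists_perm_of_map_perm {α β : Type*} {f : α → β} {l : List α} {L : List β}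
    (h : L.Perm (l.map f)) : ∃ l' : List α, l'.Perm l ∧ l'.map f = L := by
  generalize hM : l.map f = M at h
  induction h generalizing l with
  | nil => exact ⟨l, List.Perm.refl _, hM⟩
  | cons b _ ih =>
    obtain ⟨a, l, rfl, rfl, hl⟩ := List.map_eq_cons_iff.1 hM
    obtain ⟨l', hl', rfl⟩ := ih hl
    exact ⟨a :: l', hl'.cons a, rfl⟩
  | swap b c L =>
    obtain ⟨a, l, rfl, rfl, hl⟩ := List.map_eq_cons_iff.1 hM
    obtain ⟨a', l, rfl, rfl, rfl⟩ := List.map_eq_cons_iff.1 hl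
    exact ⟨a' :: a :: l, List.Perm.swap _ _ _, rfl⟩
  | trans _ _ ih₁ ih₂ =>
    obtain ⟨l₂, hl₂, rfl⟩ := ih₂ hM
    obtain ⟨l₁, hl₁, rfl⟩ := ih₁ rfl
    exact ⟨l₁, hl₁.trans hl₂, rfl⟩

/-- The vertices of finitely many finite edges, without repetition. -/
theorem exists_list_of_edges {α : Type*} (es : List (Set α)) (h3 : ∀ e ∈ es, e.ncard = 3) :
    ∃ l : List α, l.Nodup ∧ ∀ v, v ∈ l ↔ ∃ e ∈ es, v ∈ e := by
  have hfin : {v | ∃ e ∈ es, v ∈ e}.Finite := by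
    have : {v | ∃ e ∈ es, v ∈ e} = ⋃ e ∈ {e | e ∈ es}, e := by
      ext v
      simp
    rw [this]
    refine Set.Finite.biUnion (List.finite_toSet es) fun e he => ?_
    exact Set.finite_of_ncard_ne_zero (by
      rw [h3 e he]
      norm_num)
  exact ⟨hfin.toFinset.toList, Finset.nodup_toList _, fun v => by simp⟩

/-- If the vertices of three edges are ordered such that all vertices see two edges in the same
position, then the edges are exceptional. -/
theorem exists_exceptionalVectors_of_ordering {α : Type*} {es : List (Set α)} (hes : es.Nodup)
    (hlen : es.length = 3) (h3 : ∀ e ∈ es, e.ncard = 3) {g : α → ℕ}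
    (hg : Set.InjOn g {v | ∃ e ∈ es, v ∈ e})
    (hall : ∀ w, (∃ e ∈ es, w ∈ e) → ∃ e ∈ es, ∃ e' ∈ es, e ≠ e' ∧ SamePosition g w e e') :
    ∃ C ∈ exceptionalVectors, ∃ l : List α, l.Nodup ∧ (∀ v, v ∈ l ↔ ∃ e ∈ es, v ∈ e) ∧
      l.map (incidence es) = C := by
  classical
  obtain ⟨l₀, hl₀, hmem₀⟩ := exists_list_of_edges es h3
  let r : α → α → Prop := fun a b => g a ≤ g b
  have : Std.Total r := ⟨fun a b => le_total (g a) (g b)⟩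
  have : IsTrans α r := ⟨fun a b c => le_trans (a := g a)⟩
  set l := l₀.insertionSort r with hl
  have hperm : l.Perm l₀ := List.perm_insertionSort r l₀
  have hnodup : l.Nodup := hperm.nodup_iff.2 hl₀
  have hmem : ∀ v, v ∈ l ↔ ∃ e ∈ es, v ∈ e := fun v => by rw [hperm.mem_iff, hmem₀]
  have hlt : l.Pairwise (g · < g ·) := by
    refine ((List.pairwise_insertionSort r l₀).and hnodup).imp_of_mem fun {a b} ha hb hab => ?_
    exact lt_of_le_of_ne hab.1 fun h => hab.2 (hg ((hmem a).1 ha) ((hmem b).1 hb) h)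
  have hsub : ∀ e ∈ es, ∀ v ∈ e, v ∈ l := fun e he v hv => (hmem v).2 ⟨e, he, hv⟩
  have h1 := (allSeeRepeat_iff_of_pairwise hlt hsub).2 fun w hw =>
    (hasRepeat_positions hes).2 (hall w ((hmem w).1 hw))
  have h2 := isThreeGraph_map_incidence hes hnodup hsub h3
  rw [hlen] at h1 h2
  obtain ⟨C, hC, hLC⟩ := exists_perm_exceptionalVectors (fun S hS => by
    obtain ⟨v, hv, rfl⟩ := List.mem_map.1 hS
    exact ⟨true_mem_incidence.2 ((hmem v).1 hv), (length_incidence es v).trans hlen⟩) h1 h2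
  obtain ⟨l', hl', hmap⟩ := exists_perm_of_map_perm hLC.symm
  exact ⟨C, hC, l', hl'.nodup_iff.2 hnodup, fun v => by rw [hl'.mem_iff, hmem], hmap⟩

/-- An arrangement of the vertices of some edges yields an ordering of all vertices. -/
theorem exists_ordering_of_arrangement {α : Type*} {V : Set α} (hV : V.Finite)
    {es : List (Set α)} (hes : es.Nodup) (h3 : ∀ e ∈ es, e.ncard = 3)
    (htwo : ∃ e ∈ es, ∃ e' ∈ es, e ≠ e') {l : List α} (hl : l.Nodup)
    (hsub : ∀ e ∈ es, ∀ v ∈ e, v ∈ l)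
    (hall : allSeeRepeat (List.replicate es.length 0) (l.map (incidence es)) = true) :
    ∃ g : α → ℕ, Set.InjOn g V ∧
      ∀ w ∈ V, ∃ e ∈ es, ∃ e' ∈ es, e ≠ e' ∧ SamePosition g w e e' := by
  classical
  set m := (hV.toFinset.filter (· ∉ l)).toList with hm
  have hmmem : ∀ v, v ∈ m ↔ v ∈ V ∧ v ∉ l := fun v => by simp [hm]
  have hlm : (l ++ m).Nodup := List.nodup_append.2 ⟨hl, Finset.nodup_toList _, fun a ha b hb hab =>
    ((hmmem b).1 hb).2 (hab ▸ ha)⟩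
  have hpair : (l ++ m).Pairwise fun a b => (l ++ m).idxOf a < (l ++ m).idxOf b := by
    rw [List.pairwise_iff_getElem]
    intro i j hi hj hij
    rwa [hlm.idxOf_getElem, hlm.idxOf_getElem]
  rw [List.pairwise_append] at hpair
  have hVmem : ∀ v ∈ V, v ∈ l ++ m := fun v hv => by
    by_cases h : v ∈ l
    · exact List.mem_append_left _ h
    · exact List.mem_append_right _ ((hmmem v).2 ⟨hv, h⟩)
  refine ⟨fun v => (l ++ m).idxOf v, fun v hv w _ h => (List.idxOf_inj (hVmem v hv)).1 h,
    fun w hw => ?_⟩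
  by_cases hwl : w ∈ l
  · exact (hasRepeat_positions hes).1 ((allSeeRepeat_iff_of_pairwise hpair.1 hsub).1 hall w hwl)
  · obtain ⟨e, he, e', he', hne⟩ := htwo
    have hwm : w ∈ m := (hmmem w).2 ⟨hw, hwl⟩
    -- Vertices outside `l` are placed last, so each of them has all three vertices of every listed
    -- edge below it and cannot tell any two of these edges apart.
    have key : ∀ e ∈ es, w ∉ e ∧ numBelow (fun v => (l ++ m).idxOf v) e w = 3 := by
      intro e he
      refine ⟨fun h => hwl (hsub e he w h), ?_⟩
      rw [← h3 e he, numBelow]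
      congr 1
      ext v
      exact ⟨fun h => h.1, fun h => ⟨h, hpair.2.2 v (hsub e he v h) w hwm⟩⟩
    exact ⟨e, he, e', he', hne, by simp [(key e he).1, (key e' he').1],
      (key e he).2.trans (key e' he').2.symm⟩

theorem exists_ordering_of_four_edges {α : Type*} {V : Set α} (hV : V.Finite)
    {es : List (Set α)} (hes : es.Nodup) (hlen : es.length = 4) (h3 : ∀ e ∈ es, e.ncard = 3) :
    ∃ g : α → ℕ, Set.InjOn g V ∧
      ∀ w ∈ V, ∃ e ∈ es, ∃ e' ∈ es, e ≠ e' ∧ SamePosition g w e e' := by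
  obtain ⟨l₀, hl₀, hmem₀⟩ := exists_list_of_edges es h3
  have hsub : ∀ e ∈ es, ∀ v ∈ e, v ∈ l₀ := fun e he v hv => (hmem₀ v).2 ⟨e, he, hv⟩
  have h2 := isThreeGraph_map_incidence hes hl₀ hsub h3
  rw [hlen] at h2
  obtain ⟨L, hL, hall⟩ := exists_perm_allSeeRepeat (fun S hS => by
    obtain ⟨v, hv, rfl⟩ := List.mem_map.1 hS
    exact ⟨true_mem_incidence.2 ((hmem₀ v).1 hv), (length_incidence es v).trans hlen⟩) h2
  obtain ⟨l, hl, rfl⟩ := exists_perm_of_map_perm hL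
  refine exists_ordering_of_arrangement hV hes h3 ?_ (hl.nodup_iff.2 hl₀)
    (fun e he v hv => hl.mem_iff.2 (hsub e he v hv)) (by rwa [hlen])
  refine ⟨es[0], List.getElem_mem _, es[1], List.getElem_mem _, fun h => ?_⟩
  exact absurd (hes.getElem_inj_iff.1 h) (by norm_num)

/-! ### Recognising the exceptional hypergraphs -/

theorem map_incidence_TP3 : (List.finRange 5).map (incidence [{0, 1, 2}, {1, 2, 3}, {2, 3, 4}]) =
    [[true, false, false], [true, true, false], [true, true, true], [false, true, true],
      [false, false, true]] := by
  simp [incidence, List.finRange_succ]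

theorem map_incidence_SP3 : (List.finRange 6).map (incidence [{0, 1, 2}, {1, 2, 3}, {3, 4, 5}]) =
    [[true, false, false], [true, true, false], [true, true, false], [false, true, true],
      [false, false, true], [false, false, true]] := by
  simp [incidence, List.finRange_succ]

theorem map_incidence_LC3 : (List.finRange 6).map (incidence [{0, 1, 3}, {1, 2, 4}, {0, 2, 5}]) =
    [[true, false, true], [true, true, false], [false, true, true], [true, false, false],
      [false, true, false], [false, false, true]] := by
  simp [incidence, List.finRange_succ]

/-- A hypergraph with the incidence vectors of `F` is `F` with isolated vertices. -/
theorem isWithIsolatedVertices_of_incidence {α : Type*} {H : Hypergraph α} {m : ℕ}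
    {F : Hypergraph (Fin m)} {Fs : List (Set (Fin m))} (hFs : F.edgeSet = {e | e ∈ Fs})
    {es : List (Set α)} (hes : H.edgeSet = {e | e ∈ es}) (hlen : es.length = Fs.length)
    {l : List α} (hl : l.Nodup) (hmem : ∀ v, v ∈ l ↔ ∃ e ∈ es, v ∈ e)
    (h : l.map (incidence es) = (List.finRange m).map (incidence Fs)) :
    IsWithIsolatedVertices F H := by
  classical
  obtain rfl : l.length = m := by simpa using congrArg List.length h
  have hinc : ∀ i : Fin l.length, incidence es l[i] = incidence Fs i := by
    intro i
    have := congrArg (fun L => L[(i : ℕ)]?) h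
    simpa using this
  have hmap : es = Fs.map fun e => (fun i : Fin l.length => l[i]) '' e := by
    refine List.ext_getElem (by simp [hlen]) fun j h1 h2 => ?_
    have hj : j < Fs.length := hlen ▸ h1
    have hiff : ∀ i : Fin l.length, l[i] ∈ es[j] ↔ i ∈ Fs[j] := by
      intro i
      have := congrArg (fun L => L.getD j false) (hinc i)
      simp only [getD_incidence h1, getD_incidence hj] at this
      simpa using this
    rw [List.getElem_map]
    ext v
    constructor
    · intro hv
      obtain ⟨i, hi, rfl⟩ := List.mem_iff_getElem.1 ((hmem v).2 ⟨_, List.getElem_mem h1, hv⟩)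
      exact ⟨⟨i, hi⟩, (hiff ⟨i, hi⟩).1 hv, rfl⟩
    · rintro ⟨i, hi, rfl⟩
      exact (hiff i).2 hi
  refine ⟨fun i => l[i], fun i _ j _ hij => ?_, ?_, ?_⟩
  · exact Fin.ext (hl.getElem_inj_iff.1 hij)
  · rintro _ ⟨i, -, rfl⟩
    obtain ⟨e, he, hv⟩ := (hmem l[i]).1 (List.getElem_mem _)
    have heH : e ∈ H.edgeSet := by
      rw [hes]
      exact he
    exact H.subset_vertexSet_of_mem_edgeSet' heH hv
  · rw [Hypergraph.image_edgeSet, hFs, hes]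
    ext e
    conv_lhs => rw [hmap]
    simp

/-- Three edges with exceptional incidence vectors form an exceptional hypergraph. -/
theorem isWithIsolatedVertices_of_mem_exceptionalVectors {α : Type*} {H : Hypergraph α}
    {e₁ e₂ e₃ : Set α} (hE : H.edgeSet = {e₁, e₂, e₃}) {l : List α} (hl : l.Nodup)
    (hmem : ∀ v, v ∈ l ↔ ∃ e ∈ [e₁, e₂, e₃], v ∈ e)
    (hC : l.map (incidence [e₁, e₂, e₃]) ∈ exceptionalVectors) :
    IsWithIsolatedVertices TP3 H ∨ IsWithIsolatedVertices SP3 H ∨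
      IsWithIsolatedVertices LC3 H := by
  -- Renaming the edges by `p` turns each exceptional list into a standard one exactly, not merely
  -- up to reordering the vertices, because `exceptionalVectors` lists the vertices in the matching
  -- order.
  have key : ∀ C ∈ exceptionalVectors, ∃ p ∈ [(0, 1, 2), (0, 2, 1), (1, 0, 2), (1, 2, 0), (2, 0, 1),
      (2, 1, 0)], C.map (fun S => [S.getD p.1 false, S.getD p.2.1 false, S.getD p.2.2 false]) ∈
      [[[true, false, false], [true, true, false], [true, true, true], [false, true, true],
        [false, false, true]],
      [[true, false, false], [true, true, false], [true, true, false], [false, true, true],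
        [false, false, true], [false, false, true]],
      [[true, false, true], [true, true, false], [false, true, true], [true, false, false],
        [false, true, false], [false, false, true]]] := by
    decide
  have fin : ∀ es : List (Set α), es.length = 3 → (∀ e, e ∈ es ↔ e ∈ [e₁, e₂, e₃]) →
      l.map (incidence es) ∈
      [[[true, false, false], [true, true, false], [true, true, true], [false, true, true],
        [false, false, true]],
      [[true, false, false], [true, true, false], [true, true, false], [false, true, true],
        [false, false, true], [false, false, true]],
      [[true, false, true], [true, true, false], [false, true, true], [true, false, false],
        [false, true, false], [false, false, true]]] →
      IsWithIsolatedVertices TP3 H ∨ IsWithIsolatedVertices SP3 H ∨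
        IsWithIsolatedVertices LC3 H := by
    intro es hlen hes h
    have hE' : H.edgeSet = {e | e ∈ es} := by
      rw [hE]
      ext e
      simp [hes]
    have hmem' : ∀ v, v ∈ l ↔ ∃ e ∈ es, v ∈ e := by
      intro v
      simp only [hmem, hes]
    simp only [← map_incidence_TP3, ← map_incidence_SP3, ← map_incidence_LC3, List.mem_cons,
      List.not_mem_nil, or_false] at h
    refine h.imp (fun h => ?_) (Or.imp (fun h => ?_) fun h => ?_)
    · exact isWithIsolatedVertices_of_incidence (by ext e; simp [TP3]) hE' (hlen.trans rfl)
        hl hmem' h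
    · exact isWithIsolatedVertices_of_incidence (by ext e; simp [SP3]) hE' (hlen.trans rfl)
        hl hmem' h
    · exact isWithIsolatedVertices_of_incidence (by ext e; simp [LC3]) hE' (hlen.trans rfl)
        hl hmem' h
  obtain ⟨p, hp, h⟩ := key _ hC
  rw [List.map_map] at h
  simp only [List.mem_cons, List.not_mem_nil, or_false] at hp
  rcases hp with rfl | rfl | rfl | rfl | rfl | rfl
  · exact fin [e₁, e₂, e₃] rfl (by simp) h
  · exact fin [e₁, e₃, e₂] rfl (by intro e; simp only [List.mem_cons, List.not_mem_nil]; tauto) h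
  · exact fin [e₂, e₁, e₃] rfl (by intro e; simp only [List.mem_cons, List.not_mem_nil]; tauto) h
  · exact fin [e₂, e₃, e₁] rfl (by intro e; simp only [List.mem_cons, List.not_mem_nil]; tauto) h
  · exact fin [e₃, e₁, e₂] rfl (by intro e; simp only [List.mem_cons, List.not_mem_nil]; tauto) h
  · exact fin [e₃, e₂, e₁] rfl (by intro e; simp only [List.mem_cons, List.not_mem_nil]; tauto) h

/-! ### Orderings inside and outside the family -/

/-- In every ordering of the vertices of a member of the family, some vertex sees the edges in
different positions. -/
theorem exists_separating_vertex {α : Type*} {H : Hypergraph α} (hfin : H.vertexSet.Finite)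
    (hne : H.vertexSet.Nonempty) (hH : IsUniform 3 H) (hF : InFamily H) {g : α → ℕ}
    (hg : Set.InjOn g H.vertexSet) :
    ∃ w ∈ H.vertexSet, ∀ e ∈ H.edgeSet, ∀ e' ∈ H.edgeSet, SamePosition g w e e' → e = e' := by
  by_contra! hcon
  have hsub : ∀ e ∈ H.edgeSet, ∀ v ∈ e, v ∈ H.vertexSet := fun e he v hv =>
    H.subset_vertexSet_of_mem_edgeSet' he hv
  have hEfin : H.edgeSet.Finite := hfin.finite_subsets.subset fun e he => hsub e he
  obtain ⟨hcard, hTP, hSP, hLC⟩ := hF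
  rcases Nat.lt_or_eq_of_le hcard with hlt | h3
  -- With at most two edges, two edges that every vertex sees in the same position contain the same
  -- vertices, hence coincide.
  · obtain ⟨v, hv⟩ := hne
    obtain ⟨e, he, e', he', -, hne⟩ := hcon v hv
    have hE : H.edgeSet = {e, e'} := by
      refine (Set.eq_of_subset_of_ncard_le ?_ ?_ hEfin).symm
      · exact Set.insert_subset he (Set.singleton_subset_iff.2 he')
      · rw [Set.ncard_pair hne]
        omega
    have hpos : ∀ w ∈ H.vertexSet, w ∈ e ↔ w ∈ e' := by
      intro w hw
      obtain ⟨f, hf, f', hf', hs, hff⟩ := hcon w hw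
      rw [hE] at hf hf'
      rcases hf with rfl | rfl <;> rcases hf' with rfl | rfl
      · exact absurd rfl hff
      · exact hs.1
      · exact hs.1.symm
      · exact absurd rfl hff
    refine hne (Set.ext fun w => ⟨fun h => ?_, fun h => ?_⟩)
    · exact (hpos w (hsub e he w h)).1 h
    · exact (hpos w (hsub e' he' w h)).2 h
  · obtain ⟨e₁, e₂, e₃, h12, h13, h23, hE⟩ := Set.ncard_eq_three.1 h3
    have hmemE : ∀ e, e ∈ H.edgeSet ↔ e ∈ [e₁, e₂, e₃] := fun e => by simp [hE]
    obtain ⟨C, hC, l, hl, hmem, rfl⟩ := exists_exceptionalVectors_of_ordering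
      (es := [e₁, e₂, e₃]) (by simp [h12, h13, h23]) rfl (fun e he => hH e ((hmemE e).2 he))
      (g := g) (hg.mono fun v ⟨e, he, hv⟩ => hsub e ((hmemE e).2 he) v hv) (by
        rintro w ⟨e, he, hw⟩
        obtain ⟨f, hf, f', hf', hs, hff⟩ := hcon w (hsub e ((hmemE e).2 he) w hw)
        exact ⟨f, (hmemE f).1 hf, f', (hmemE f').1 hf', hff, hs⟩)
    rcases isWithIsolatedVertices_of_mem_exceptionalVectors hE hl hmem hC with h | h | h
    · exact hTP h
    · exact hSP h
    · exact hLC h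

/-- An arrangement of the vertices of `F` gives an ordering of a hypergraph that is `F` with
isolated vertices. -/
theorem exists_ordering_of_isWithIsolatedVertices {α : Type*} {H : Hypergraph α}
    (hfin : H.vertexSet.Finite) (hH : IsUniform 3 H) {m : ℕ} {F : Hypergraph (Fin m)}
    (hFV : F.vertexSet = Set.univ) {Fs : List (Set (Fin m))} (hFs : F.edgeSet = {e | e ∈ Fs})
    (hnodup : Fs.Nodup) (hlen : 2 ≤ Fs.length) {o : List (Fin m)} (ho : o.Nodup)
    (ho' : ∀ i, i ∈ o)
    (hall : allSeeRepeat (List.replicate Fs.length 0) (o.map (incidence Fs)) = true)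
    (h : IsWithIsolatedVertices F H) :
    ∃ g : α → ℕ, Set.InjOn g H.vertexSet ∧ ∀ w ∈ H.vertexSet,
      ∃ e ∈ H.edgeSet, ∃ e' ∈ H.edgeSet, e ≠ e' ∧ SamePosition g w e e' := by
  obtain ⟨φ, hφ, -, hE⟩ := h
  rw [hFV, Set.injOn_univ] at hφ
  have hE' : ∀ e, e ∈ H.edgeSet ↔ e ∈ Fs.map (φ '' ·) := by
    intro e
    rw [hE, Hypergraph.image_edgeSet, hFs]
    simp
  have hes : (Fs.map (φ '' ·)).Nodup := hnodup.map hφ.image_injective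
  have hinc : (o.map φ).map (incidence (Fs.map (φ '' ·))) = o.map (incidence Fs) := by
    rw [List.map_map]
    refine List.map_congr_left fun i _ => ?_
    simp [incidence, Function.comp_def, hφ.mem_set_image]
  obtain ⟨g, hg, hgw⟩ := exists_ordering_of_arrangement hfin hes
    (fun e he => hH e ((hE' e).2 he))
    ⟨_, List.getElem_mem (n := 0) (by rw [List.length_map]; omega), _,
      List.getElem_mem (n := 1) (by rw [List.length_map]; omega),
      fun h => absurd (hes.getElem_inj_iff.1 h) (by norm_num)⟩
    (l := o.map φ) (ho.map hφ) (by
      intro e he v hv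
      obtain ⟨f, -, rfl⟩ := List.mem_map.1 he
      obtain ⟨i, -, rfl⟩ := hv
      exact List.mem_map_of_mem (ho' i)) (by rwa [hinc, List.length_map])
  refine ⟨g, hg, fun w hw => ?_⟩
  obtain ⟨e, he, e', he', hne, hs⟩ := hgw w hw
  exact ⟨e, (hE' e).2 he, e', (hE' e').2 he', hne, hs⟩

/-- The vertices of a hypergraph outside the family have an ordering in which no vertex sees the
edges in different positions. -/
theorem exists_ordering_of_not_inFamily {α : Type*} {H : Hypergraph α}
    (hfin : H.vertexSet.Finite) (hH : IsUniform 3 H) (hF : ¬ InFamily H) :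
    ∃ g : α → ℕ, Set.InjOn g H.vertexSet ∧ ∀ w ∈ H.vertexSet,
      ∃ e ∈ H.edgeSet, ∃ e' ∈ H.edgeSet, e ≠ e' ∧ SamePosition g w e e' := by
  classical
  by_cases hcard : H.edgeSet.ncard ≤ 3
  · have h3 : IsWithIsolatedVertices TP3 H ∨ IsWithIsolatedVertices SP3 H ∨
        IsWithIsolatedVertices LC3 H := by
      unfold InFamily at hF
      tauto
    rcases h3 with h | h | h
    -- The list `o` is an explicit bad order; here it is `a, c, d, b, e`.
    · refine exists_ordering_of_isWithIsolatedVertices hfin hH rfl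
        (Fs := [{0, 1, 2}, {1, 2, 3}, {2, 3, 4}]) (by ext e; simp [TP3]) ?_ (by simp)
        (o := [0, 2, 3, 1, 4]) (by decide) (by decide) ?_ h
      · simp [Set.ext_iff, Fin.forall_fin_succ]
      · simp [incidence, allSeeRepeat, seesRepeat, advance, hasRepeat]
    · refine exists_ordering_of_isWithIsolatedVertices hfin hH rfl
        (Fs := [{0, 1, 2}, {1, 2, 3}, {3, 4, 5}]) (by ext e; simp [SP3]) ?_ (by simp)
        (o := [0, 3, 1, 2, 4, 5]) (by decide) (by decide) ?_ h
      · simp [Set.ext_iff, Fin.forall_fin_succ]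
      · simp [incidence, allSeeRepeat, seesRepeat, advance, hasRepeat]
    · refine exists_ordering_of_isWithIsolatedVertices hfin hH rfl
        (Fs := [{0, 1, 3}, {1, 2, 4}, {0, 2, 5}]) (by ext e; simp [LC3]) ?_ (by simp)
        (o := [0, 4, 1, 5, 2, 3]) (by decide) (by decide) ?_ h
      · simp [Set.ext_iff, Fin.forall_fin_succ]
      · simp [incidence, allSeeRepeat, seesRepeat, advance, hasRepeat]
  -- Four of the edges suffice: a coincidence among them remains one among all edges.
  · obtain ⟨E, hE, hE4⟩ := Set.exists_subset_card_eq (s := H.edgeSet) (n := 4) (by omega)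
    have hEfin : E.Finite := Set.finite_of_ncard_ne_zero (by omega)
    have hmem : ∀ e ∈ hEfin.toFinset.toList, e ∈ H.edgeSet := fun e he => hE (by simpa using he)
    obtain ⟨g, hg, hgw⟩ := exists_ordering_of_four_edges hfin (es := hEfin.toFinset.toList)
      (Finset.nodup_toList _) (by rw [Finset.length_toList, ← Set.ncard_eq_toFinset_card E hEfin, hE4])
      (fun e he => hH e (hmem e he))
    refine ⟨g, hg, fun w hw => ?_⟩
    obtain ⟨e, he, e', he', hne, hs⟩ := hgw w hw
    exact ⟨e, hmem e he, e', hmem e' he', hne, hs⟩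

/-! ### The upper bound: seven colours -/

theorem numBelow_le_three {α : Type*} {g : α → ℕ} {e : Set α} (he : e.ncard = 3) (w : α) :
    numBelow g e w ≤ 3 := by
  rw [← he]
  exact Set.ncard_le_ncard (fun v hv => hv.1) (Set.finite_of_ncard_ne_zero (by omega))

theorem numBelow_le_two {α : Type*} {g : α → ℕ} {e : Set α} (he : e.ncard = 3) {w : α}
    (hw : w ∈ e) : numBelow g e w ≤ 2 := by
  have hfin : e.Finite := Set.finite_of_ncard_ne_zero (by omega)
  refine Nat.le_of_lt_succ ?_
  rw [show Nat.succ 2 = e.ncard from he.symm]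
  refine Set.ncard_lt_ncard ⟨fun v hv => hv.1, fun h => ?_⟩ hfin
  exact lt_irrefl _ (h hw).2

open Classical in
/-- Colouring the edges by their position relative to the vertex is a local colouring for each
member of the family. -/
theorem localRainbowNumber_le_seven {α : Type*} {H : Hypergraph α} (hfin : H.vertexSet.Finite)
    (hne : H.vertexSet.Nonempty) (hH : IsUniform 3 H) (hF : InFamily H) (n : ℕ) :
    localRainbowNumber 3 n H ≤ 7 := by
  -- Colours 0 to 3 serve the edges that avoid `u`, colours 4 to 6 those that contain it.
  refine Nat.sInf_le ⟨fun u e => if h : u ∈ e.1 then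
      ⟨4 + numBelow Fin.val e.1 u, by have := numBelow_le_two (g := Fin.val) e.2 h; omega⟩
    else ⟨numBelow Fin.val e.1 u, by have := numBelow_le_three (g := Fin.val) e.2 u; omega⟩, ?_⟩
  rintro T ⟨φ, hφ, rfl⟩
  -- The copy orders the vertices of `H` by their images in `Fin n`.
  obtain ⟨w, hw, hsep⟩ := exists_separating_vertex hfin hne hH hF
    (g := fun v => (φ v : ℕ)) (fun v hv w hw h => hφ hv hw (Fin.ext h))
  refine ⟨φ w, Set.mem_image_of_mem φ hw, ?_⟩
  have hpos : ∀ e ∈ H.edgeSet, (φ w ∈ φ '' e ↔ w ∈ e) ∧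
      numBelow Fin.val (φ '' e) (φ w) =
        numBelow (fun v => (φ v : ℕ)) e w := by
    intro e he
    have hsub : e ⊆ H.vertexSet := H.subset_vertexSet_of_mem_edgeSet' he
    refine ⟨hφ.mem_image_iff hsub hw, ?_⟩
    have : {v | v ∈ φ '' e ∧ (v : ℕ) < (φ w : ℕ)} = φ '' {v | v ∈ e ∧ (φ v : ℕ) < (φ w : ℕ)} := by
      ext v
      constructor
      · rintro ⟨⟨v, hv, rfl⟩, h⟩
        exact ⟨v, ⟨hv, h⟩, rfl⟩
      · rintro ⟨v, ⟨hv, h⟩, rfl⟩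
        exact ⟨⟨v, hv, rfl⟩, h⟩
    rw [numBelow, this, (hφ.mono fun v hv => hsub hv.1).ncard_image, numBelow]
  rintro ⟨_, h₁⟩ ⟨_, h₂⟩ ⟨e₁, he₁, rfl⟩ ⟨e₂, he₂, rfl⟩ heq
  have h3 := numBelow_le_three (g := fun v => (φ v : ℕ)) (hH e₁ he₁) w
  have h4 := numBelow_le_three (g := fun v => (φ v : ℕ)) (hH e₂ he₂) w
  have hsame : SamePosition (fun v => (φ v : ℕ)) w e₁ e₂ := by
    have heq' := congrArg Fin.val heq
    unfold SamePosition
    by_cases hw1 : w ∈ e₁ <;> by_cases hw2 : w ∈ e₂ <;>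
      simp only [(hpos e₁ he₁).1, (hpos e₁ he₁).2, (hpos e₂ he₂).1, (hpos e₂ he₂).2, hw1, hw2,
        dif_pos, dif_neg, not_false_eq_true, true_iff, iff_true] at heq' ⊢ <;> simp <;> omega
  exact Subtype.ext (congrArg (φ '' ·) (hsep e₁ he₁ e₂ he₂ hsame))

/-! ### The lower bound: homogeneous sets and bad orders -/

theorem exists_enumeration {β : Type*} [LinearOrder β] {S : Finset β} {s : ℕ} (hS : S.card = s) :
    ∃ x : Fin s → β, StrictMono x ∧ (∀ i, x i ∈ S) ∧
      ∀ p ∈ S, ∃ i : Fin s, x i = p ∧ (i : ℕ) = (S.filter (· < p)).card := by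
  classical
  refine ⟨S.orderEmbOfFin hS, (S.orderEmbOfFin hS).strictMono, S.orderEmbOfFin_mem hS,
    fun p hp => ?_⟩
  have hp' : p ∈ Set.range (S.orderEmbOfFin hS) := by
    rw [Finset.range_orderEmbOfFin]
    exact hp
  obtain ⟨i, rfl⟩ := hp'
  refine ⟨i, rfl, ?_⟩
  have : S.filter (· < S.orderEmbOfFin hS i) =
      (Finset.Iio i).image (S.orderEmbOfFin hS) := by
    ext v
    simp only [Finset.mem_filter, Finset.mem_image, Finset.mem_Iio]
    constructor
    · rintro ⟨hv, hlt⟩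
      have hv' : v ∈ Set.range (S.orderEmbOfFin hS) := by
        rw [Finset.range_orderEmbOfFin]
        exact hv
      obtain ⟨j, rfl⟩ := hv'
      exact ⟨j, (S.orderEmbOfFin hS).lt_iff_lt.1 hlt, rfl⟩
    · rintro ⟨j, hj, rfl⟩
      exact ⟨S.orderEmbOfFin_mem hS j, (S.orderEmbOfFin hS).lt_iff_lt.2 hj⟩
  rw [this, Finset.card_image_of_injective _ (S.orderEmbOfFin hS).injective, Fin.card_Iio]

/-- The colours that four vertices give to the triples among them that omit the vertex itself or the
last vertex. -/
def tupleColor {β κ : Type*} (F : β → Set β → κ) (x : Fin 4 → β) : Fin 4 ⊕ Fin 4 → κ :=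
  Sum.elim (fun i => F (x i) (Set.range x \ {x i})) fun i => F (x i) (Set.range x \ {x 3})

/-- The first part compares triples seen by an outside vertex `p`. In the second, `r` and `r'` are
the top elements, which serve to complete to a 4-set a triple seen by one of its own vertices. -/
theorem eq_of_isHomogeneous {β κ : Type*} [LinearOrder β] {F : β → Set β → κ} {A : Finset β}
    (hA : IsHomogeneous (tupleColor F) A) {S S' : Finset β} (hSA : S ⊆ A) (hSA' : S' ⊆ A)
    (hS : S.card = 4) (hS' : S'.card = 4) {p p' : β} (hp : p ∈ S) (hp' : p' ∈ S')
    (hpp : (S.filter (· < p)).card = (S'.filter (· < p')).card) :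
    F p (S.erase p) = F p' (S'.erase p') ∧
    ∀ r ∈ S, (S.filter (· < r)).card = 3 → ∀ r' ∈ S', (S'.filter (· < r')).card = 3 →
      F p (S.erase r) = F p' (S'.erase r') := by
  have hrange : ∀ {S : Finset β} {x : Fin 4 → β}, (∀ i, x i ∈ S) →
      (∀ p ∈ S, ∃ i : Fin 4, x i = p ∧ (i : ℕ) = (S.filter (· < p)).card) →
      Set.range x = S := by
    intro S x h1 h2
    ext v
    constructor
    · rintro ⟨i, rfl⟩
      exact h1 i
    · intro hv
      obtain ⟨i, hi, -⟩ := h2 v hv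
      exact ⟨i, hi⟩
  obtain ⟨x, hx, hxS, hxp⟩ := exists_enumeration hS
  obtain ⟨x', hx', hxS', hxp'⟩ := exists_enumeration hS'
  have hc := hA x x' hx hx' (fun i => hSA (hxS i)) fun i => hSA' (hxS' i)
  obtain ⟨i, rfl, hi⟩ := hxp p hp
  obtain ⟨i', rfl, hi'⟩ := hxp' p' hp'
  obtain rfl : i = i' := Fin.ext (hi.trans (hpp.trans hi'.symm))
  constructor
  · have := congrFun hc (Sum.inl i)
    simpa [tupleColor, hrange hxS hxp, hrange hxS' hxp'] using this
  · intro r hr h3 r' hr' h3'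
    obtain ⟨j, rfl, hj⟩ := hxp r hr
    obtain ⟨j', rfl, hj'⟩ := hxp' r' hr'
    obtain rfl : j = 3 := Fin.ext (hj.trans h3)
    obtain rfl : j' = 3 := Fin.ext (hj'.trans h3')
    have := congrFun hc (Sum.inr i)
    simpa [tupleColor, hrange hxS hxp, hrange hxS' hxp'] using this

/-- In a large enough homogeneous set, the vertices of `H` can be placed in any given order, and the
colours of the edges depend on their positions only. -/
theorem exists_placement {α β κ : Type*} [LinearOrder β] {F : β → Set β → κ} {A : Finset β}
    (hA : IsHomogeneous (tupleColor F) A) {V : Set α} (hV : V.Finite) (hVA : V.ncard < A.card)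
    {g : α → ℕ} (hg : Set.InjOn g V) :
    ∃ φ : α → β, Set.InjOn φ V ∧ ∀ w ∈ V, ∀ e e' : Set α, e ⊆ V → e' ⊆ V → e.ncard = 3 →
      e'.ncard = 3 → SamePosition g w e e' → F (φ w) (φ '' e) = F (φ w) (φ '' e') := by
  classical
  obtain ⟨B, hBA, hB⟩ := Finset.exists_subset_card_eq (s := A) (n := V.ncard + 1) hVA
  set ψ := B.orderEmbOfFin hB with hψ
  set rank : α → ℕ := fun v => {w | w ∈ V ∧ g w < g v}.ncard with hrank
  have hfin : ∀ v, {w | w ∈ V ∧ g w < g v}.Finite := fun v => hV.subset fun w hw => hw.1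
  have hrank_lt : ∀ v ∈ V, rank v < V.ncard := fun v hv =>
    Set.ncard_lt_ncard ⟨fun w hw => hw.1, fun h => lt_irrefl _ (h hv).2⟩ hV
  have hrank_mono : ∀ v ∈ V, ∀ w ∈ V, g v < g w → rank v < rank w := fun v hv w _ hvw =>
    Set.ncard_lt_ncard ⟨fun u hu => ⟨hu.1, hu.2.trans hvw⟩,
      fun h => lt_irrefl _ (h ⟨hv, hvw⟩).2⟩ (hfin w)
  -- On `V` the rank is below `V.ncard`, so the reduction in `Fin.ofNat` is harmless and the top
  -- element of `B` remains free. It is the spare `z` above the image of `V`.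
  set φ : α → β := fun v => ψ (Fin.ofNat (V.ncard + 1) (rank v)) with hφ
  set z := ψ (Fin.last _) with hz
  have hzA : z ∈ A := hBA (B.orderEmbOfFin_mem hB _)
  have hφA : ∀ v, φ v ∈ A := fun v => hBA (B.orderEmbOfFin_mem hB _)
  have hφlt : ∀ v ∈ V, ∀ w ∈ V, g v < g w → φ v < φ w := by
    intro v hv w hw hvw
    refine ψ.strictMono (Fin.lt_def.2 ?_)
    have h1 := hrank_lt v hv
    have h2 := hrank_lt w hw
    simp only [Fin.ofNat, Nat.mod_eq_of_lt (h1.trans (Nat.lt_succ_self _)),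
      Nat.mod_eq_of_lt (h2.trans (Nat.lt_succ_self _))]
    exact hrank_mono v hv w hw hvw
  have hφz : ∀ v ∈ V, φ v < z := by
    intro v hv
    refine ψ.strictMono (Fin.lt_def.2 ?_)
    have h1 := hrank_lt v hv
    simpa only [Fin.ofNat, Nat.mod_eq_of_lt (h1.trans (Nat.lt_succ_self _)), Fin.val_last]
  have hlt_iff : ∀ v ∈ V, ∀ w ∈ V, φ v < φ w ↔ g v < g w := by
    intro v hv w hw
    refine ⟨fun h => ?_, hφlt v hv w hw⟩
    by_contra hle
    rcases (not_lt.1 hle).lt_or_eq with hlt | heq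
    · exact h.not_gt (hφlt w hw v hv hlt)
    · exact h.ne (congrArg φ (hg hv hw heq.symm))
  have hinj : Set.InjOn φ V := by
    intro v hv w hw h
    by_contra hne
    rcases lt_or_gt_of_ne (fun h => hne (hg hv hw h) : g v ≠ g w) with hlt | hlt
    · exact (hφlt v hv w hw hlt).ne h
    · exact (hφlt w hw v hv hlt).ne h.symm
  refine ⟨φ, hinj, fun w hw e e' heV heV' he he' hs => ?_⟩
  have hfilter : ∀ e : Finset α, (e : Set α) ⊆ V → ((e.image φ).filter (· < φ w)).card =
      numBelow g (e : Set α) w := by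
    intro e heV
    have h1 : (e.image φ).filter (· < φ w) = (e.filter fun v => g v < g w).image φ := by
      ext v
      simp only [Finset.mem_filter, Finset.mem_image]
      constructor
      · rintro ⟨⟨v, hv, rfl⟩, h⟩
        exact ⟨v, ⟨hv, (hlt_iff v (heV hv) w hw).1 h⟩, rfl⟩
      · rintro ⟨v, ⟨hv, h⟩, rfl⟩
        exact ⟨⟨v, hv, rfl⟩, (hlt_iff v (heV hv) w hw).2 h⟩
    rw [h1, Finset.card_image_of_injOn, numBelow, ← Set.ncard_coe_finset]
    · congr 1
      ext v
      simp
    · exact hinj.mono fun v hv => heV (Finset.mem_filter.1 hv).1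
  lift e to Finset α using Set.finite_of_ncard_ne_zero (by omega)
  lift e' to Finset α using Set.finite_of_ncard_ne_zero (by omega)
  rw [Set.ncard_coe_finset] at he he'
  rw [← Finset.coe_image, ← Finset.coe_image]
  have hcard : ∀ e : Finset α, (e : Set α) ⊆ V → e.card = 3 → (e.image φ).card = 3 :=
    fun e heV he => by rw [Finset.card_image_of_injOn (hinj.mono heV), he]
  have hsubA : ∀ e : Finset α, e.image φ ⊆ A := fun e v hv => by
    obtain ⟨u, -, rfl⟩ := Finset.mem_image.1 hv
    exact hφA u
  -- If `w ∈ e`, the 4-set is the image of `e` together with `z`, and omitting its last element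
  -- recovers the edge. Otherwise it is the image of `e` together with `φ w`, and the omitted
  -- element is the observer itself.
  by_cases hwe : w ∈ e
  · have hwe' : w ∈ e' := hs.1.1 hwe
    have hzn : ∀ e : Finset α, (e : Set α) ⊆ V → z ∉ e.image φ := by
      intro e heV hze
      obtain ⟨v, hv, hvz⟩ := Finset.mem_image.1 hze
      exact (hφz v (heV hv)).ne hvz
    have hfilter' : ∀ e : Finset α, (e : Set α) ⊆ V →
        ((insert z (e.image φ)).filter (· < φ w)).card = numBelow g (e : Set α) w := by
      intro e heV
      rw [Finset.filter_insert, if_neg (hφz w hw).not_gt, hfilter e heV]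
    have hfilterz : ∀ e : Finset α, (e : Set α) ⊆ V → e.card = 3 →
        ((insert z (e.image φ)).filter (· < z)).card = 3 := by
      intro e heV he
      rw [Finset.filter_insert, if_neg (lt_irrefl z), Finset.filter_true_of_mem, hcard e heV he]
      intro v hv
      obtain ⟨u, hu, rfl⟩ := Finset.mem_image.1 hv
      exact hφz u (heV hu)
    have := (eq_of_isHomogeneous hA (S := insert z (e.image φ)) (S' := insert z (e'.image φ))
      (Finset.insert_subset hzA (hsubA e)) (Finset.insert_subset hzA (hsubA e'))
      (by rw [Finset.card_insert_of_notMem (hzn e heV), hcard e heV he])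
      (by rw [Finset.card_insert_of_notMem (hzn e' heV'), hcard e' heV' he'])
      (Finset.mem_insert_of_mem (Finset.mem_image_of_mem φ hwe))
      (Finset.mem_insert_of_mem (Finset.mem_image_of_mem φ hwe'))
      (by rw [hfilter' e heV, hfilter' e' heV', hs.2])).2
      z (Finset.mem_insert_self _ _) (hfilterz e heV he)
      z (Finset.mem_insert_self _ _) (hfilterz e' heV' he')
    rwa [Finset.erase_insert (hzn e heV), Finset.erase_insert (hzn e' heV')] at this
  · have hwe' : w ∉ e' := fun h => hwe (hs.1.2 h)
    have hwn : ∀ e : Finset α, (e : Set α) ⊆ V → w ∉ e → φ w ∉ e.image φ := by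
      intro e heV hwe h
      obtain ⟨v, hv, hvw⟩ := Finset.mem_image.1 h
      exact hwe (hinj (heV hv) hw hvw ▸ hv)
    have hfilter' : ∀ e : Finset α, (e : Set α) ⊆ V →
        ((insert (φ w) (e.image φ)).filter (· < φ w)).card = numBelow g (e : Set α) w := by
      intro e heV
      rw [Finset.filter_insert, if_neg (lt_irrefl _), hfilter e heV]
    have := (eq_of_isHomogeneous hA (S := insert (φ w) (e.image φ))
      (S' := insert (φ w) (e'.image φ))
      (Finset.insert_subset (hφA w) (hsubA e)) (Finset.insert_subset (hφA w) (hsubA e'))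
      (by rw [Finset.card_insert_of_notMem (hwn e heV hwe), hcard e heV he])
      (by rw [Finset.card_insert_of_notMem (hwn e' heV' hwe'), hcard e' heV' he'])
      (Finset.mem_insert_self _ _) (Finset.mem_insert_self _ _)
      (by rw [hfilter' e heV, hfilter' e' heV', hs.2])).1
    rwa [Finset.erase_insert (hwn e heV hwe), Finset.erase_insert (hwn e' heV' hwe')] at this

/-- Local colourings for a hypergraph outside the family exist for few vertices only. -/
theorem lt_of_isLocalColoring {α : Type*} {H : Hypergraph α} (hfin : H.vertexSet.Finite)
    (hH : IsUniform 3 H) (hF : ¬ InFamily H) {n k : ℕ} (hk : 1 ≤ k)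
    {f : Fin n → CompleteEdge 3 n → Fin k} (hf : IsLocalColoring H f) :
    n < 2 ^ 2 ^ 2 ^ (12 * (H.vertexSet.ncard + 2) * k ^ 16) := by
  classical
  obtain ⟨g, hg, hgw⟩ := exists_ordering_of_not_inFamily hfin hH hF
  have : Nonempty (Fin k) := ⟨⟨0, hk⟩⟩
  by_contra! hn
  -- The default colour is never used: only values on 3-sets enter the conclusion.
  set F : Fin n → Set (Fin n) → Fin k := fun u s =>
    if h : s.ncard = 3 then f u ⟨s, h⟩ else Classical.arbitrary _ with hFdef
  have hbound : ramseyBound (Fintype.card (Fin 4 ⊕ Fin 4 → Fin k)) (H.vertexSet.ncard + 1) 3 ≤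
      (Finset.univ : Finset (Fin n)).card := by
    have hcard : Fintype.card (Fin 4 ⊕ Fin 4 → Fin k) = k ^ 8 := by simp
    have hk8 : 1 ≤ k ^ 8 := Nat.one_le_pow _ _ hk
    rw [hcard, Finset.card_univ, Fintype.card_fin]
    refine (ramseyBound_three_le (k ^ 8) _ hk8).trans (le_trans ?_ hn)
    refine Nat.pow_le_pow_right two_pos (Nat.pow_le_pow_right two_pos
      (Nat.pow_le_pow_right two_pos ?_))
    have : k ^ 16 = k ^ 8 * k ^ 8 := by ring
    rw [this]
    nlinarith [Nat.mul_le_mul_left (k ^ 8) hk8]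
  obtain ⟨A, -, hAcard, hA⟩ := exists_isHomogeneous (H.vertexSet.ncard + 1) 3 (tupleColor F)
    Finset.univ hbound
  obtain ⟨φ, hφ, hφF⟩ := exists_placement hA hfin hAcard hg
  obtain ⟨u, ⟨w, hw, rfl⟩, hu⟩ := hf (H.image φ) ⟨φ, hφ, rfl⟩
  obtain ⟨e, he, e', he', hne, hs⟩ := hgw w hw
  have hsub : ∀ e ∈ H.edgeSet, e ⊆ H.vertexSet := fun e he => H.subset_vertexSet_of_mem_edgeSet' he
  have hcard : ∀ e ∈ H.edgeSet, (φ '' e).ncard = 3 := fun e he => by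
    rw [(hφ.mono (hsub e he)).ncard_image, hH e he]
  have heq := hφF w hw e e' (hsub e he) (hsub e' he') (hH e he) (hH e' he') hs
  simp only [hFdef, dif_pos (hcard e he), dif_pos (hcard e' he')] at heq
  have := congrArg Subtype.val (hu ⟨_, hcard e he⟩ ⟨_, hcard e' he'⟩
    (Set.mem_image_of_mem _ he) (Set.mem_image_of_mem _ he') heq)
  exact hne ((hφ.image_eq_image_iff (hsub e he) (hsub e' he')).1 this)

theorem lt_of_not_inFamily {α : Type*} {H : Hypergraph α} (hfin : H.vertexSet.Finite)
    (hne : H.vertexSet.Nonempty) (hH : IsUniform 3 H) (hF : ¬ InFamily H) (n : ℕ) :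
    n < 2 ^ 2 ^ 2 ^ (12 * (H.vertexSet.ncard + 2) * localRainbowNumber 3 n H ^ 16) := by
  obtain ⟨f, hf⟩ := (localRainbowNumber_isLeast 3 n H hne).1
  rcases Nat.eq_zero_or_pos (localRainbowNumber 3 n H) with h0 | hpos
  -- A colouring with no colours leaves no triple to colour; the bound then reads `n < 4`.
  · have hn : n < 3 := by
      by_contra! hn
      obtain ⟨s, -, hs⟩ := Set.exists_subset_card_eq (s := (Set.univ : Set (Fin n))) (n := 3)
        (by simpa using hn)
      have := (f ⟨0, by omega⟩ ⟨s, hs⟩).2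
      omega
    rw [h0]
    norm_num
    omega
  · exact lt_of_isLocalColoring hfin hH hF hpos hf

/-- Each logarithm removes one base 2 from the tower, at no cost since `log 2 ≤ 1`. -/
theorem iterate_three_log_le {n x : ℕ} (hn : n < 2 ^ 2 ^ 2 ^ x) (h1 : 0 < Real.log n)
    (h2 : 0 < Real.log (Real.log n)) : Real.log^[3] (n : ℝ) ≤ x := by
  have hlog : ∀ y : ℕ, Real.log ((2 : ℝ) ^ y) ≤ y := by
    intro y
    rw [Real.log_pow]
    exact mul_le_of_le_one_right (Nat.cast_nonneg y) (Real.log_two_lt_d9.le.trans (by norm_num))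
  have hn0 : (0 : ℝ) < n := by
    rcases Nat.eq_zero_or_pos n with rfl | h
    · simp at h1
    · exact_mod_cast h
  have hle : (n : ℝ) ≤ (2 : ℝ) ^ (2 ^ 2 ^ x) := by exact_mod_cast hn.le
  have h3 : Real.log n ≤ (2 : ℝ) ^ (2 ^ x) := by
    have := (Real.log_le_log hn0 hle).trans (hlog _)
    exact_mod_cast this
  have h4 : Real.log (Real.log n) ≤ (2 : ℝ) ^ x := by
    have := (Real.log_le_log h1 h3).trans (hlog _)
    exact_mod_cast this
  exact (Real.log_le_log h2 h4).trans (hlog _)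

/-- The triply logarithmic lower bound for hypergraphs outside the family. -/
theorem exists_lower_bound_of_not_inFamily {α : Type*} {H : Hypergraph α}
    (hfin : H.vertexSet.Finite) (hne : H.vertexSet.Nonempty) (hH : IsUniform 3 H)
    (hF : ¬ InFamily H) :
    ∃ c : ℝ, 0 < c ∧ ∀ᶠ n : ℕ in Filter.atTop,
      c * (Real.log^[3] (n : ℝ) / Real.log^[4] (n : ℝ)) ^ (1 / 16 : ℝ) ≤
        (localRainbowNumber 3 n H : ℝ) := by
  set D : ℝ := 12 * ((H.vertexSet.ncard : ℝ) + 2) with hD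
  have hDpos : 0 < D := by positivity
  refine ⟨(D ^ (1 / 16 : ℝ))⁻¹, by positivity, ?_⟩
  have t1 : Filter.Tendsto (fun n : ℕ => Real.log (n : ℝ)) Filter.atTop Filter.atTop :=
    Real.tendsto_log_atTop.comp tendsto_natCast_atTop_atTop
  have t2 := Real.tendsto_log_atTop.comp t1
  have t3 := Real.tendsto_log_atTop.comp t2
  have t4 := Real.tendsto_log_atTop.comp t3
  filter_upwards [t1.eventually_gt_atTop 0, t2.eventually_gt_atTop 0, t3.eventually_gt_atTop 0,
    t4.eventually_ge_atTop 1] with n h1 h2 h3 h4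
  have h3' : 0 ≤ Real.log^[3] (n : ℝ) := le_of_lt h3
  have h4' : 1 ≤ Real.log^[4] (n : ℝ) := h4
  have hle := iterate_three_log_le (lt_of_not_inFamily hfin hne hH hF n) h1 h2
  rw [inv_mul_le_iff₀ (by positivity)]
  calc (Real.log^[3] (n : ℝ) / Real.log^[4] (n : ℝ)) ^ (1 / 16 : ℝ)
      ≤ (D * (localRainbowNumber 3 n H : ℝ) ^ 16) ^ (1 / 16 : ℝ) := by
        refine Real.rpow_le_rpow (by positivity) ?_ (by norm_num)
        -- The bound without the denominator already holds; dividing by a fourth logarithm that is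
        -- at least 1 only weakens it.
        refine (div_le_self h3' h4').trans (hle.trans (le_of_eq ?_))
        push_cast
        rfl
    _ = D ^ (1 / 16 : ℝ) * (localRainbowNumber 3 n H : ℝ) := by
        rw [Real.mul_rpow hDpos.le (by positivity), ← Real.rpow_natCast,
          ← Real.rpow_mul (by positivity)]
        norm_num

end LocalRainbow

theorem theorem1 {α : Type*} (H : Hypergraph α) (hfin : H.vertexSet.Finite)
    (hne : H.vertexSet.Nonempty) (hH : LocalRainbow.IsUniform 3 H) :
    (LocalRainbow.InFamily H → ∀ n : ℕ, LocalRainbow.localRainbowNumber 3 n H ≤ 7) ∧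
    (¬ LocalRainbow.InFamily H → ∃ c : ℝ, 0 < c ∧ ∀ᶠ n : ℕ in Filter.atTop,
      c * (Real.log^[3] (n : ℝ) / Real.log^[4] (n : ℝ)) ^ (1 / 16 : ℝ) ≤
        (LocalRainbow.localRainbowNumber 3 n H : ℝ)) ∧
    ((∃ C : ℕ, ∀ n : ℕ, LocalRainbow.localRainbowNumber 3 n H ≤ C) ↔
      LocalRainbow.InFamily H) := by
  refine ⟨LocalRainbow.localRainbowNumber_le_seven hfin hne hH,
    LocalRainbow.exists_lower_bound_of_not_inFamily hfin hne hH, ?_,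
    fun hF => ⟨7, LocalRainbow.localRainbowNumber_le_seven hfin hne hH hF⟩⟩
  rintro ⟨C, hC⟩
  by_contra hF
  -- The threshold is evaluated at the supposed bound `C`, so the explicit inequality fails at `n =
  -- N`; no asymptotics are needed.
  set N := 2 ^ 2 ^ 2 ^ (12 * (H.vertexSet.ncard + 2) * C ^ 16) with hN
  refine (LocalRainbow.lt_of_not_inFamily hfin hne hH hF N).not_ge ?_
  exact Nat.pow_le_pow_right two_pos (Nat.pow_le_pow_right two_pos (Nat.pow_le_pow_right two_pos
    (Nat.mul_le_mul_left _ (Nat.pow_le_pow_left (hC N) 16))))
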